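/- Let $C=(S,\mathit{Act},R)$ be a continuous-time Markov decision process with finite $S$ and $\mathit{Act}$, rates $R(s,a,s')\ge 0$, and a nonempty set $\mathit{Act}(s)$ of enabled actions in every state ($R(s,a,\cdot)=0$ for $a\notin \mathit{Act}(s)$). Put $E(s,a)=\sum_{s'}R(s,a,s')$ and $\lambda_{\min}=\max_{s,a}E(s,a)$. Let $G\subseteq S$, $T\ge 0$, $\mathsf x\in\{\text{late},\text{early}\}$, $\varepsilon>0$ and $\kappa\in(0,1)$. A timed scheduler maps the timed history $s_0t_0s_1\dots s_n$ and the time spent in $s_n$ measurably to a distribution over the enabled actions; a late scheduler may change its decision while time passes in $s_n$, an early one chooses its action on entering $s_n$. Let $\mathrm{val}_s$ be the supremum, over the timed schedulers of class $\mathsf x$, of the probability to reach $G$ from $s$ within time $T$. *Uniformisation.* For $\lambda\ge\lambda_{\min}$, the late uniformisation $C^{\text{late}}_\lambda$ has states $S$, the same enabled actions, and, for enabled $a$, rates $R(s,a,s')$ if $s\ne s'$ and $\lambda-\sum_{s''\neq s}R(s,a,s'')$ if $s'=s$. The early uniformisation $C^{\text{early}}_\lambda$ has states $S\times(\{\bot\}\cup\mathit{Act})$;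 enabled in $(s,\bot)$ are the actions in $\mathit{Act}(s)$, and in $(s,a)$ only the action $a$; an enabled action $a$ leads from $(s,\cdot)$ to $(s',\bot)$ with rate $R(s,a,s')$, to $(s,a)$ with rate $\lambda-E(s,a)$, and nowhere else. In the early case a state is a goal state if its first component is in $G$, and $s\in S$ is identified with $(s,\bot)$. Let $P_\lambda$ be the transition probabilities (rate divided by exit rate) of $C^{\mathsf x}_\lambda$. *Algorithm.* For $\lambda=\lambda_{\min},2\lambda_{\min},4\lambda_{\min},\dots$ put $\psi(i)=e^{-\lambda T}(\lambda T)^i/i!$ and $N=\lceil\lambda Te^2-\ln(\varepsilon\kappa)\rceil$ (with $N=0$ if this is negative), and compute on the states $u$ of $C^{\mathsf x}_\lambda$, for $0\le k\le N$, $$\underline v^k_u=\begin{cases}0&k=N\\ \sum_{i=k}^{N-1}\psi(i)&k<N,\ u\text{ goal}\\ \max_a\sum_{u'}P_\lambda(u,a,u')\,\underline v^{k+1}_{u'}&\text{otherwise,}\end{cases}\qquad w^k_u=\begin{cases}0&k=N\\ 1&k<N,\ u\text{ goal}\\ \max_a\sum_{u'}P_\lambda(u,a,u')\,w^{k+1}_{u'}&\text{otherwise,}\end{cases}$$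 and $\overline v^0_u=\sum_{i=0}^{N-1}\psi(i)\,w^{N-1-i}_u$, with maxima over the enabled actions; stop at the first $\lambda$ with $\lVert\overline v^0-\underline v^0\rVert_\infty\le\varepsilon(1-\kappa)$. *Stochastic-update schedulers.* A timed stochastic-update scheduler $(M,\sigma_u,\pi_0)$ has a countable memory set $M$, an initial distribution $\pi_0$ on $M$, and a function $\sigma_u$ that maps the memory element, the state and the time $t$ spent there (measurably in $t$) to a distribution over pairs (enabled action, new memory element); if it is early, the distribution of the action does not depend on $t$. In the late case the state $s$ is left for $s'$ with new memory element $m'$ at time $t$ with intensity $\sum_a\sigma_u(m,s,t)(a,m')R(s,a,s')$. In the early case the action $a$ is drawn on entry, the sojourn time is exponential with rate $E(s,a)$, the successor has distribution $R(s,a,\cdot)/E(s,a)$, and when $s$ is left at time $t$ the new memory element is drawn from $\sigma_u(m,s,t)$ conditioned on $a$. **Statement.** The algorithm terminates. Let $\lambda$ be the rate of its last iteration. Enabled actions $d_k(s)$ $(k\in\mathbb N,\ s\in S)$ that attain the maximum defining $\underline v^k_s$ whenever $k<N$ and $s\notin G$ exist, and for every choice of such $d$ the following stochastic-update scheduler of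 class $\mathsf x$ with memory $\mathbb N$ is $\varepsilon$-optimal in $C$, i.e. from every $s\in S$ it reaches $G$ within time $T$ with probability at least $\mathrm{val}_s-\varepsilon$. The memory starts at $0$ and stores the number of transitions of $C^{\mathsf x}_\lambda$ taken so far. At time $t$ after entering $s$ with memory $m$, a number $n$ of simulated self-loops is drawn with probability proportional to $\frac{t^n}{n!}\prod_{i<n}r_i$ (the distribution of the number of self-loops made by time $t$, given that $s$ has not been left), where $r_i=\lambda-E(s,d_{m+i}(s))$ in the late and $r_i=\lambda-E(s,d_m(s))$ in the early case. The action is $d_{m+n}(s)$ in the late and $d_m(s)$ in the early case, and the new memory element is $m+n+1$. -/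

import Mathlib

open MeasureTheory ProbabilityTheory Finset
open scoped ENNReal NNReal Nat

/-- A finite continuous-time Markov decision process `(S, Act, R)`. Every state has a nonempty
set of enabled actions; actions that are not enabled have rate zero. -/
structure CTMDP (S Act : Type*) where
  rate : S → Act → S → ℝ
  rate_nonneg : ∀ s a s', 0 ≤ rate s a s'
  enabled : S → Finset Act
  enabled_nonempty : ∀ s, (enabled s).Nonempty
  rate_disabled : ∀ s a s', a ∉ enabled s → rate s a s' = 0

/-- The two scheduler classes: a late scheduler may reconsider its action while time passes in a
state, an early scheduler commits to an action when the state is entered. -/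
inductive Timing
  | late
  | early

noncomputable section

namespace CTMDP

section Basic

variable {S Act : Type*} [Fintype S]

/-- Exit rate `E(s, a)`. -/
def exit (C : CTMDP S Act) (s : S) (a : Act) : ℝ := ∑ s', C.rate s a s'

/-- Transition probability matrix of the embedded jump process. -/
def prob (C : CTMDP S Act) (s : S) (a : Act) (s' : S) : ℝ := C.rate s a s' / C.exit s a

/-- The maximal exit rate. -/
def maxExit (C : CTMDP S Act) : ℝ := ⨆ p : S × Act, C.exit p.1 p.2

theorem exit_nonneg (C : CTMDP S Act) (s : S) (a : Act) : 0 ≤ C.exit s a :=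
  Finset.sum_nonneg fun s' _ => C.rate_nonneg s a s'

theorem maxExit_nonneg (C : CTMDP S Act) : 0 ≤ C.maxExit :=
  Real.iSup_nonneg fun p => C.exit_nonneg p.1 p.2

theorem sum_le_exit (C : CTMDP S Act) (s : S) (a : Act) (t : Finset S) :
    ∑ s' ∈ t, C.rate s a s' ≤ C.exit s a :=
  Finset.sum_le_sum_of_subset_of_nonneg (Finset.subset_univ _)
    fun s' _ _ => C.rate_nonneg s a s'

/-- The uniformisation rate in iteration `j = 0, 1, 2, …` of the algorithm. -/
def rateAt (C : CTMDP S Act) (j : ℕ) : ℝ := 2 ^ j * C.maxExit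

theorem maxExit_le_rateAt (C : CTMDP S Act) (j : ℕ) : C.maxExit ≤ C.rateAt j :=
  le_mul_of_one_le_left C.maxExit_nonneg (one_le_pow₀ one_le_two)

variable [Fintype Act]

theorem exit_le_maxExit (C : CTMDP S Act) (s : S) (a : Act) : C.exit s a ≤ C.maxExit :=
  le_ciSup (f := fun p : S × Act => C.exit p.1 p.2) (Set.finite_range _).bddAbove (s, a)

open Classical in
/-- Late uniformisation to rate `l`: self-loops fill up every exit rate to `l`. -/
def lateUnif (C : CTMDP S Act) (l : ℝ) (hl : C.maxExit ≤ l) : CTMDP S Act where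
  rate s a s' :=
    if a ∈ C.enabled s then
      if s = s' then l - ∑ s'' ∈ univ.erase s, C.rate s a s'' else C.rate s a s'
    else 0
  rate_nonneg s a s' := by
    split_ifs
    · have h1 := C.sum_le_exit s a (univ.erase s)
      have h2 := C.exit_le_maxExit s a
      linarith
    · exact C.rate_nonneg s a s'
    · exact le_rfl
  enabled := C.enabled
  enabled_nonempty := C.enabled_nonempty
  rate_disabled s a s' h := by simp [h]

open Classical in
/-- Early uniformisation to rate `l`. The state `(s, none)` is the original state `s`, with no
action committed to; in `(s, some a)` the choice of `a` is frozen, so `a` is the only enabled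
action there. -/
def earlyUnif (C : CTMDP S Act) (l : ℝ) (hl : C.maxExit ≤ l) : CTMDP (S × Option Act) Act where
  rate u a v :=
    if a ∈ u.2.elim (C.enabled u.1) (fun b => {b}) then
      if v.2 = none then C.rate u.1 a v.1
      else if v.2 = some a ∧ u.1 = v.1 then l - C.exit u.1 a
      else 0
    else 0
  rate_nonneg u a v := by
    split_ifs
    · exact C.rate_nonneg _ _ _
    · have h2 := C.exit_le_maxExit u.1 a
      linarith
    · exact le_rfl
    · exact le_rfl
  enabled u := u.2.elim (C.enabled u.1) (fun b => {b})
  enabled_nonempty u := by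
    rcases u with ⟨s, _ | b⟩
    · exact C.enabled_nonempty s
    · exact Finset.singleton_nonempty b
  rate_disabled u a v h := by simp [h]

end Basic

section Values

/-- Poisson probability of the point `i` for the parameter `r`. -/
def pois (r : ℝ) (i : ℕ) : ℝ := Real.exp (-r) * r ^ i / i !

/-- The truncation point `⌈l T e² - ln (ε κ)⌉` (zero if this number is negative). -/
def truncation (l T ε κ : ℝ) : ℕ := ⌈l * T * Real.exp 1 ^ 2 - Real.log (ε * κ)⌉₊

variable {U Act : Type*} [Fintype U]

/-- `max_a ∑_{u'} P(u, a, u') · v(u')`, over the enabled actions. -/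
def bellman (D : CTMDP U Act) (v : U → ℝ) (u : U) : ℝ :=
  (D.enabled u).sup' (D.enabled_nonempty u) fun a => ∑ u', D.prob u a u' * v u'

open Classical in
/-- The backward recursion for the lower bound, indexed by `r = N - k`, with weights `w`. -/
def lowerRem (D : CTMDP U Act) (G : Set U) (w : ℕ → ℝ) (N : ℕ) : ℕ → U → ℝ
  | 0 => fun _ => 0
  | r + 1 => fun u =>
      if u ∈ G then ∑ i ∈ Finset.Ico (N - (r + 1)) N, w i
      else D.bellman (lowerRem D G w N r) u

/-- The value of the lower-bound recursion at step `k`, for `0 ≤ k ≤ N`. -/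
def lowerVal (D : CTMDP U Act) (G : Set U) (w : ℕ → ℝ) (N k : ℕ) : U → ℝ :=
  D.lowerRem G w N (N - k)

open Classical in
/-- The backward recursion of step-bounded reachability, indexed by `r = N - k`. -/
def reachRem (D : CTMDP U Act) (G : Set U) : ℕ → U → ℝ
  | 0 => fun _ => 0
  | r + 1 => fun u => if u ∈ G then 1 else D.bellman (reachRem D G r) u

/-- The upper-bound value at step `k`, for `0 ≤ k ≤ N`. -/
def upperVal (D : CTMDP U Act) (G : Set U) (w : ℕ → ℝ) (N k : ℕ) (u : U) : ℝ :=
  ∑ i ∈ Finset.Ico k N, w i * D.reachRem G (N - ((N - 1) - (i - k))) u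

/-- Supremum norm of the difference between the computed upper and lower bound vectors. -/
def gap (D : CTMDP U Act) (G : Set U) (w : ℕ → ℝ) (N : ℕ) : ℝ :=
  ‖D.upperVal G w N 0 - D.lowerVal G w N 0‖

/-- Action `a` attains the maximum in the step-`k` equation of the lower bound at `u` (any
enabled action does where that equation contains no maximum). -/
def IsMaximiser (D : CTMDP U Act) (G : Set U) (w : ℕ → ℝ) (N k : ℕ) (u : U) (a : Act) : Prop :=
  a ∈ D.enabled u ∧
    (k < N → u ∉ G → ∑ u', D.prob u a u' * D.lowerVal G w N (k + 1) u' = D.lowerVal G w N k u)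

end Values

section Algorithm

variable {S Act : Type*} [Fintype S] [Fintype Act]

/-- The goal states of the early uniformisation. -/
def earlyGoal (Act : Type*) {S : Type*} (G : Set S) : Set (S × Option Act) := {u | u.1 ∈ G}

/-- The termination test of iteration `j`. -/
def Stops (C : CTMDP S Act) (x : Timing) (G : Set S) (T ε κ : ℝ) (j : ℕ) : Prop :=
  let w := pois (C.rateAt j * T)
  let N := truncation (C.rateAt j) T ε κ
  match x with
  | .late => (C.lateUnif (C.rateAt j) (C.maxExit_le_rateAt j)).gap G w N ≤ ε * (1 - κ)
  | .early =>
      (C.earlyUnif (C.rateAt j) (C.maxExit_le_rateAt j)).gap (earlyGoal Act G) w N ≤ ε * (1 - κ)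

/-- The algorithm leaves its loop in iteration `j`. -/
def Terminates (C : CTMDP S Act) (x : Timing) (G : Set S) (T ε κ : ℝ) (j : ℕ) : Prop :=
  C.Stops x G T ε κ j ∧ ∀ i < j, ¬ C.Stops x G T ε κ i

/-- `d k s` is an enabled action that attains the maximum in the equation of iteration `j` for
step `k` at `s` (late) or at `(s, ⊥)` (early): the untimed scheduler read off the values. -/
def IsGreedy (C : CTMDP S Act) (x : Timing) (G : Set S) (T ε κ : ℝ) (j : ℕ)
    (d : ℕ → (s : S) → C.enabled s) : Prop :=
  let w := pois (C.rateAt j * T)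
  let N := truncation (C.rateAt j) T ε κ
  ∀ k s, match x with
  | .late =>
      (C.lateUnif (C.rateAt j) (C.maxExit_le_rateAt j)).IsMaximiser G w N k s (d k s)
  | .early =>
      (C.earlyUnif (C.rateAt j) (C.maxExit_le_rateAt j)).IsMaximiser (earlyGoal Act G) w N k
        (s, none) (d k s)

end Algorithm

section Jump

variable {S Act M : Type*} [Fintype S] [Fintype Act]

/-- The probability that the decision `p` specifies action `a`. -/
def actionProb (p : PMF (Act × M)) (a : Act) : ℝ := (p.map Prod.fst a).toReal

/-- The hazard accumulated during the first `t` time units in `s`. Late: the exit rates of the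
actions prescribed at the successive times are integrated. Early: the action `a` was fixed on
entry. -/
def hazard (C : CTMDP S Act) (x : Timing) (s : S) (p : ℝ → PMF (Act × M)) (a : Act) (t : ℝ) : ℝ :=
  match x with
  | .late => ∫ u in (0 : ℝ)..t, ∑ b, actionProb (p u) b * C.exit s b
  | .early => C.exit s a * t

/-- Joint density of: leaving `s` at sojourn time `t`, to `s'`, with new memory `m'`, when the
decision at sojourn time `u` is `p u`, a distribution over actions and new memory elements. In the
early case the action marginal of `p u` does not depend on `u`; it is the law of the action
fixed on entry. -/
def jumpDensity (C : CTMDP S Act) (x : Timing) (s : S) (p : ℝ → PMF (Act × M))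
    (t : ℝ) (s' : S) (m' : M) : ℝ≥0∞ :=
  ∑ a, p t (a, m') * ENNReal.ofReal (C.rate s a s' * Real.exp (-C.hazard x s p a t))

end Jump

section Normalisation

/-- Normalisation of hazard densities. -/
theorem lintegral_hazard_le_one {K : ℝ} {η : ℝ → ℝ} (hm : Measurable η) (h0 : ∀ t, 0 ≤ η t)
    (hK : ∀ t, η t ≤ K) :
    ∫⁻ t in Set.Ioi (0 : ℝ), ENNReal.ofReal (η t * Real.exp (-∫ u in (0 : ℝ)..t, η u)) ≤ 1 := by
  have hint : ∀ a b, IntervalIntegrable η volume a b := fun a b => by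
    refine (intervalIntegrable_const (c := K)).mono_fun hm.aestronglyMeasurable ?_
    filter_upwards with t
    rw [Real.norm_of_nonneg (h0 t), Real.norm_of_nonneg ((h0 t).trans (hK t))]
    exact hK t
  set F : ℝ → ℝ := fun t => ∫ u in (0 : ℝ)..t, η u with hF
  have hF0 : ∀ t, 0 ≤ t → 0 ≤ F t := fun t ht =>
    intervalIntegral.integral_nonneg ht fun u _ => h0 u
  have hFlip : ∀ a b, |F a - F b| ≤ K * |a - b| := fun a b => by
    have : F a - F b = ∫ u in b..a, η u :=
      intervalIntegral.integral_interval_sub_left (hint 0 a) (hint 0 b)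
    rw [this, ← Real.norm_eq_abs (∫ u in b..a, η u)]
    refine intervalIntegral.norm_integral_le_of_norm_le_const fun t _ => ?_
    rw [Real.norm_of_nonneg (h0 t)]
    exact hK t
  have hK0 : 0 ≤ K := (h0 0).trans (hK 0)
  have hFc : Continuous F := intervalIntegral.continuous_primitive hint 0
  have key : ∀ b : ℝ, 0 ≤ b →
      ∫⁻ t in Set.Ioc 0 b, ENNReal.ofReal (η t * Real.exp (-F t)) ≤ 1 := by
    intro b hb
    have hgl : LipschitzOnWith (Real.toNNReal K) (fun t => Real.exp (-F t)) (Set.uIcc 0 b) := by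
      rw [Set.uIcc_of_le hb]
      refine LipschitzOnWith.of_dist_le_mul fun s hs t ht => ?_
      rw [Real.coe_toNNReal K hK0]
      refine le_trans ?_ (hFlip s t)
      have aux : ∀ p q : ℝ, 0 ≤ p → p ≤ q → |Real.exp (-p) - Real.exp (-q)| ≤ |p - q| := by
        intro p q hp hpq
        have e1 : Real.exp (-q) ≤ Real.exp (-p) := Real.exp_le_exp.2 (by linarith)
        rw [abs_of_nonneg (by linarith), abs_of_nonpos (by linarith)]
        have e2 : Real.exp (-q) = Real.exp (-p) * Real.exp (p - q) := by
          rw [← Real.exp_add]; ring_nf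
        have e3 := Real.add_one_le_exp (p - q)
        have e4 : Real.exp (-p) ≤ 1 := Real.exp_le_one_iff.2 (by linarith)
        have e5 := Real.exp_pos (-p)
        rw [e2]
        nlinarith
      rw [Real.dist_eq]
      rcases le_total (F s) (F t) with h | h
      · exact aux _ _ (hF0 s hs.1) h
      · rw [abs_sub_comm, abs_sub_comm (F s)]
        exact aux _ _ (hF0 t ht.1) h
    have hac := hgl.absolutelyContinuousOnInterval
    have hftc := hac.integral_deriv_eq_sub
    have hloc : LocallyIntegrable η volume := by
      intro t
      refine ⟨Set.Icc (t - 1) (t + 1), Icc_mem_nhds (by linarith) (by linarith), ?_⟩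
      exact (intervalIntegrable_iff_integrableOn_Icc_of_le (by linarith)).1 (hint _ _)
    have hder : ∀ᵐ t, HasDerivAt F (η t) t := by
      filter_upwards [LocallyIntegrable.ae_hasDerivAt_integral hloc] with t ht
      exact ht 0
    have hae : ∀ᵐ t, deriv (fun t => Real.exp (-F t)) t = -(η t * Real.exp (-F t)) := by
      filter_upwards [hder] with t ht
      have h1 : HasDerivAt (fun t => Real.exp (-F t)) (Real.exp (-F t) * -η t) t := ht.neg.exp
      rw [h1.deriv]
      ring
    have hgi : Integrable (fun t => η t * Real.exp (-F t)) (volume.restrict (Set.Ioc 0 b)) := by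
      refine Measure.integrableOn_of_bounded (M := K) (by simp)
        (hm.mul (Real.measurable_exp.comp hFc.measurable.neg)).aestronglyMeasurable ?_
      filter_upwards [ae_restrict_mem measurableSet_Ioc] with t ht
      have e4 : Real.exp (-F t) ≤ 1 := Real.exp_le_one_iff.2 (by linarith [hF0 t ht.1.le])
      have e5 := Real.exp_pos (-F t)
      rw [Real.norm_of_nonneg (mul_nonneg (h0 t) e5.le)]
      nlinarith [h0 t, hK t]
    rw [← ofReal_integral_eq_lintegral_ofReal hgi
      (Filter.Eventually.of_forall fun t => mul_nonneg (h0 t) (Real.exp_pos _).le)]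
    rw [ENNReal.ofReal_le_one]
    rw [intervalIntegral.integral_congr_ae (hae.mono fun t ht _ => ht),
      intervalIntegral.integral_neg, intervalIntegral.integral_of_le hb] at hftc
    have := Real.exp_pos (-F b)
    have e0 : Real.exp (-F 0) = 1 := by simp [hF]
    linarith
  have hU : Set.Ioi (0 : ℝ) = ⋃ n : ℕ, Set.Ioc (0 : ℝ) n := by
    ext t
    simp only [Set.mem_Ioi, Set.mem_iUnion, Set.mem_Ioc]
    exact ⟨fun h => (exists_nat_ge t).imp fun n hn => ⟨h, hn⟩, fun ⟨_, h, _⟩ => h⟩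
  rw [hU, setLIntegral_iUnion_of_directed]
  · exact iSup_le fun n => key n n.cast_nonneg
  · refine Monotone.directed_le fun m n hmn => Set.Ioc_subset_Ioc_right (by exact_mod_cast hmn)

theorem actionProb_nonneg {Act M : Type*} (p : PMF (Act × M)) (a : Act) : 0 ≤ actionProb p a :=
  ENNReal.toReal_nonneg

theorem actionProb_le_one {Act M : Type*} (p : PMF (Act × M)) (a : Act) : actionProb p a ≤ 1 :=
  ENNReal.toReal_le_of_le_ofReal zero_le_one (by
    rw [ENNReal.ofReal_one]; exact PMF.coe_le_one _ a)

theorem map_fst_apply {Act M : Type*} (p : PMF (Act × M)) (a : Act) :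
    p.map Prod.fst a = ∑' m, p (a, m) := by
  classical
  rw [PMF.map_apply, ENNReal.tsum_prod', tsum_eq_single a]
  · simp
  · intro b hb
    simp [hb.symm]

theorem ofReal_actionProb {Act M : Type*} (p : PMF (Act × M)) (a : Act) :
    ENNReal.ofReal (actionProb p a) = ∑' m, p (a, m) := by
  rw [actionProb, ENNReal.ofReal_toReal (PMF.apply_ne_top _ _), map_fst_apply]

theorem measurable_actionProb {Ω Act M : Type*} [MeasurableSpace Ω] [Countable M]
    {p : Ω → PMF (Act × M)} (hp : ∀ q, Measurable fun z => p z q) (a : Act) :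
    Measurable fun z => actionProb (p z) a := by
  simp only [actionProb, map_fst_apply]
  exact (Measurable.tsum fun m => hp (a, m)).ennreal_toReal

variable {S Act : Type*} [Fintype S] [Fintype Act]

theorem measurable_comp_discrete {Ω S : Type*} [MeasurableSpace Ω] [MeasurableSpace S]
    [DiscreteMeasurableSpace S] [Countable S] {F : S → Ω → ℝ} (hF : ∀ s, Measurable (F s))
    {g : Ω → S} (hg : Measurable g) : Measurable fun z => F (g z) z := by
  have h1 : Measurable fun y : Ω × S => F y.2 y.1 := measurable_from_prod_countable_left hF
  exact h1.comp (measurable_id.prodMk hg)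

/-- Joint measurability of an integral with variable upper limit. -/
theorem measurable_integral_upTo {Ω : Type*} [MeasurableSpace Ω] {f : Ω × ℝ → ℝ}
    (hf : Measurable f) : Measurable fun z : Ω × ℝ => ∫ u in (0 : ℝ)..z.2, f (z.1, u) := by
  have h1 : Measurable fun y : (Ω × ℝ) × ℝ => f (y.1.1, y.2) := hf.comp (by fun_prop)
  have h2 : ∀ A : Set ((Ω × ℝ) × ℝ), MeasurableSet A →
      Measurable fun z : Ω × ℝ => ∫ u in Prod.mk z ⁻¹' A, f (z.1, u) := by
    intro A hA
    have h3 := ((h1.indicator hA).stronglyMeasurable.integral_prod_right'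
      (ν := (volume : Measure ℝ))).measurable
    convert h3 using 2 with z
    rw [← integral_indicator (measurable_prodMk_left hA)]
    rfl
  simp only [intervalIntegral]
  refine (h2 {y | 0 < y.2 ∧ y.2 ≤ y.1.2} ?_).sub (h2 {y | y.1.2 < y.2 ∧ y.2 ≤ 0} ?_)
  · exact (measurableSet_lt measurable_const measurable_snd).inter
      (measurableSet_le measurable_snd (by fun_prop))
  · exact (measurableSet_lt (by fun_prop) measurable_snd).inter
      (measurableSet_le measurable_snd measurable_const)

/-- The jump densities have total mass at most one. -/
theorem lintegral_jumpDensity_le_one {M : Type*} [Countable M] [MeasurableSpace M]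
    [DiscreteMeasurableSpace M]
    (C : CTMDP S Act) (x : Timing) (s : S) (p : ℝ → PMF (Act × M))
    (hp : ∀ q, Measurable fun t => p t q)
    (he : x = .early → ∀ t t', 0 ≤ t → 0 ≤ t' → (p t).map Prod.fst = (p t').map Prod.fst) :
    ∫⁻ t in Set.Ioi (0 : ℝ), ∑' z : S × M, C.jumpDensity x s p t z.1 z.2 ≤ 1 := by
  have hsum : ∀ t, ∑' z : S × M, C.jumpDensity x s p t z.1 z.2 =
      ∑ a, ENNReal.ofReal (actionProb (p t) a) *
        ENNReal.ofReal (C.exit s a * Real.exp (-C.hazard x s p a t)) := by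
    intro t
    rw [ENNReal.tsum_prod', tsum_fintype]
    have : ∀ s', ∑' m', C.jumpDensity x s p t s' m' = ∑ a, ENNReal.ofReal (actionProb (p t) a) *
        ENNReal.ofReal (C.rate s a s' * Real.exp (-C.hazard x s p a t)) := by
      intro s'
      simp only [jumpDensity]
      rw [Summable.tsum_finsetSum fun _ _ => ENNReal.summable]
      refine Finset.sum_congr rfl fun a _ => ?_
      rw [ENNReal.tsum_mul_right, ofReal_actionProb]
    simp only [this]
    rw [Finset.sum_comm]
    refine Finset.sum_congr rfl fun a _ => ?_
    rw [← Finset.mul_sum, ← ENNReal.ofReal_sum_of_nonneg, ← Finset.sum_mul, exit]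
    exact fun s' _ => mul_nonneg (C.rate_nonneg _ _ _) (Real.exp_pos _).le
  simp only [hsum]
  cases x with
  | late =>
    have hη : Measurable fun t => ∑ b, actionProb (p t) b * C.exit s b :=
      Finset.measurable_sum _ fun b _ => (measurable_actionProb hp b).mul_const _
    refine le_trans (le_of_eq ?_) (lintegral_hazard_le_one (K := ∑ b, C.exit s b) hη
      (fun t => Finset.sum_nonneg fun b _ =>
        mul_nonneg (actionProb_nonneg _ _) (C.exit_nonneg _ _))
      (fun t => Finset.sum_le_sum fun b _ =>
        mul_le_of_le_one_left (C.exit_nonneg _ _) (actionProb_le_one _ _)))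
    refine lintegral_congr fun t => ?_
    simp only [hazard]
    rw [Finset.sum_mul, ENNReal.ofReal_sum_of_nonneg]
    · refine Finset.sum_congr rfl fun a _ => ?_
      rw [← ENNReal.ofReal_mul (actionProb_nonneg _ _), mul_assoc]
    · exact fun a _ => mul_nonneg (mul_nonneg (actionProb_nonneg _ _) (C.exit_nonneg _ _))
        (Real.exp_pos _).le
  | early =>
    have h1 : ∫⁻ t in Set.Ioi (0 : ℝ), ∑ a, ENNReal.ofReal (actionProb (p t) a) *
          ENNReal.ofReal (C.exit s a * Real.exp (-C.hazard .early s p a t)) =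
        ∫⁻ t in Set.Ioi (0 : ℝ), ∑ a, ENNReal.ofReal (actionProb (p 0) a) *
          ENNReal.ofReal (C.exit s a * Real.exp (-C.hazard .early s p a t)) := by
      refine setLIntegral_congr_fun measurableSet_Ioi fun t ht => ?_
      simp only [actionProb]
      rw [he rfl t 0 (le_of_lt ht) le_rfl]
    have hmeas : ∀ a, Measurable fun t : ℝ =>
        ENNReal.ofReal (C.exit s a * Real.exp (-C.hazard .early s p a t)) := by
      intro a
      simp only [hazard]
      fun_prop
    rw [h1, lintegral_finsetSum _ fun a _ => (hmeas a).const_mul _]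
    have h2 : ∀ a, ∫⁻ t in Set.Ioi (0 : ℝ), ENNReal.ofReal (actionProb (p 0) a) *
        ENNReal.ofReal (C.exit s a * Real.exp (-C.hazard .early s p a t)) ≤
        ENNReal.ofReal (actionProb (p 0) a) := by
      intro a
      rw [lintegral_const_mul _ (hmeas a)]
      refine mul_le_of_le_one_right zero_le ?_
      have := lintegral_hazard_le_one (K := C.exit s a) (η := fun _ => C.exit s a)
        measurable_const (fun _ => C.exit_nonneg s a) (fun _ => le_rfl)
      simpa [hazard, mul_comm] using this
    refine (Finset.sum_le_sum fun a _ => h2 a).trans ?_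
    have h3 : ∑ a, ENNReal.ofReal (actionProb (p 0) a) = ∑' q, p 0 q := by
      rw [ENNReal.tsum_prod', tsum_fintype]
      simp only [ofReal_actionProb]
    rw [h3, PMF.tsum_coe]

end Normalisation

section Scheduler

/-- One entry of a run: the time spent in the previous state (`0` initially, `∞` if no
jump ever happens), the state, and the memory element on entry to it. -/
abbrev Entry (S M : Type*) : Type _ := ℝ≥0∞ × S × M

/-- Histories with `n` jumps. -/
abbrev Hist (S M : Type*) (n : ℕ) : Type _ := (Finset.Iic n) → Entry S M

/-- The last entry of a history. -/
def Hist.last {S M : Type*} {n : ℕ} (h : Hist S M n) : Entry S M :=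
  h ⟨n, Finset.mem_Iic.2 le_rfl⟩

variable {S Act : Type*} [MeasurableSpace S]

/-- A measurable randomised timed scheduler of class `x`, with memory set `M`. Given the history
and the time `t ≥ 0` spent in the current state it yields a distribution over the
action and the next memory element. For an early scheduler the distribution of the action does not
depend on the time spent in the current state. -/
structure Scheduler (C : CTMDP S Act) (x : Timing) (M : Type*) [MeasurableSpace M] where
  init : PMF M
  decision : (n : ℕ) → Hist S M n → ℝ → PMF (Act × M)
  measurable_decision : ∀ n q, Measurable fun z : Hist S M n × ℝ => decision n z.1 z.2 q
  decision_enabled : ∀ n h t a m, a ∉ C.enabled (Hist.last h).2.1 → decision n h t (a, m) = 0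
  decision_early : x = .early → ∀ n h t t', 0 ≤ t → 0 ≤ t' →
    (decision n h t).map Prod.fst = (decision n h t').map Prod.fst

/-- Timed history-dependent schedulers: the decision depends on the timed history and on the
time spent in the current state, and there is no memory besides (one memory element only). -/
abbrev TimedScheduler (C : CTMDP S Act) (x : Timing) : Type _ := Scheduler C x Unit



variable {M : Type*} [MeasurableSpace M]

theorem measurable_last (n : ℕ) : Measurable (Hist.last : Hist S M n → Entry S M) :=
  measurable_pi_apply _

variable [Fintype S] [Fintype Act]

namespace Scheduler

variable {C : CTMDP S Act} {x : Timing}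

/-- The joint law, on the event that the current state is ever left, of the sojourn time, the next
state and the next memory element after the history `h`. -/
def jumpMeasure (σ : Scheduler C x M) (n : ℕ) (h : Hist S M n) : Measure (ℝ × S × M) :=
  ((volume.restrict (Set.Ioi 0)).prod Measure.count).withDensity fun z =>
    C.jumpDensity x (Hist.last h).2.1 (σ.decision n h) z.1 z.2.1 z.2.2

/-- The law of the next entry of the run; the missing mass is the probability that the current
state is never left. -/
def stepMeasure (σ : Scheduler C x M) (n : ℕ) (h : Hist S M n) : Measure (Entry S M) :=
  (σ.jumpMeasure n h).map (fun z => (ENNReal.ofReal z.1, z.2)) +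
    (1 - σ.jumpMeasure n h Set.univ) • Measure.dirac (∞, (Hist.last h).2)

variable [DiscreteMeasurableSpace S] [Countable M] [DiscreteMeasurableSpace M]

theorem measurable_hazard (σ : Scheduler C x M) (n : ℕ) (a : Act) :
    Measurable fun z : Hist S M n × ℝ =>
      C.hazard x (Hist.last z.1).2.1 (σ.decision n z.1) a z.2 := by
  have key : ∀ s, Measurable fun z : Hist S M n × ℝ =>
      C.hazard x s (σ.decision n z.1) a z.2 := by
    intro s
    cases x with
    | late =>
      refine measurable_integral_upTo
        (f := fun z : Hist S M n × ℝ => ∑ b, actionProb (σ.decision n z.1 z.2) b * C.exit s b) ?_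
      exact Finset.measurable_sum _ fun b _ =>
        (measurable_actionProb (σ.measurable_decision n) b).mul_const _
    | early =>
      exact measurable_snd.const_mul _
  have hl : Measurable fun z : Hist S M n × ℝ => (Hist.last z.1).2.1 :=
    ((measurable_last n).comp measurable_fst).snd.fst
  have h := measurable_comp_discrete
    (F := fun s (z : Hist S M n × ℝ) => C.hazard x s (σ.decision n z.1) a z.2) key hl
  exact h

theorem measurable_jumpDensity (σ : Scheduler C x M) (n : ℕ) :
    Measurable (Function.uncurry fun (h : Hist S M n) (z : ℝ × S × M) =>
      C.jumpDensity x (Hist.last h).2.1 (σ.decision n h) z.1 z.2.1 z.2.2) := by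
  have h1 : Measurable fun y : (Hist S M n × ℝ) × (S × M) =>
      C.jumpDensity x (Hist.last y.1.1).2.1 (σ.decision n y.1.1) y.1.2 y.2.1 y.2.2 := by
    refine measurable_from_prod_countable_left fun q => ?_
    simp only [jumpDensity]
    refine Finset.measurable_sum _ fun a _ => ?_
    refine (σ.measurable_decision n (a, q.2)).mul (Measurable.ennreal_ofReal ?_)
    refine Measurable.mul ?_ (σ.measurable_hazard n a).neg.exp
    exact (Measurable.of_discrete (f := fun s : S => C.rate s a q.1)).comp
      ((measurable_last n).comp measurable_fst).snd.fst
  exact h1.comp (by fun_prop : Measurable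
    fun y : Hist S M n × (ℝ × S × M) => ((y.1, y.2.1), y.2.2))

theorem jumpMeasure_univ_le_one (σ : Scheduler C x M) (n : ℕ) (h : Hist S M n) :
    σ.jumpMeasure n h Set.univ ≤ 1 := by
  have hm : Measurable fun z : ℝ × S × M =>
      C.jumpDensity x (Hist.last h).2.1 (σ.decision n h) z.1 z.2.1 z.2.2 :=
    (σ.measurable_jumpDensity n).comp measurable_prodMk_left
  rw [jumpMeasure, withDensity_apply _ MeasurableSet.univ, Measure.restrict_univ,
    lintegral_prod _ hm.aemeasurable]
  simp only [lintegral_count]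
  exact lintegral_jumpDensity_le_one C x _ _
    (fun q => (σ.measurable_decision n q).comp measurable_prodMk_left)
    (fun hx t t' => σ.decision_early hx n h t t')

/-- The step kernel of the controlled process. -/
def stepKernel (σ : Scheduler C x M) (n : ℕ) : Kernel (Hist S M n) (Entry S M) where
  toFun := σ.stepMeasure n
  measurable' := by
    have h1 : Measurable (σ.jumpMeasure n) := by
      have := (((Kernel.const (Hist S M n)
        ((volume.restrict (Set.Ioi (0 : ℝ))).prod (Measure.count : Measure (S × M)))).withDensity
        fun h z => C.jumpDensity x (Hist.last h).2.1 (σ.decision n h) z.1 z.2.1 z.2.2)).measurable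
      convert this using 1
      funext h
      rw [Kernel.withDensity_apply _ (σ.measurable_jumpDensity n), Kernel.const_apply]
      rfl
    refine Measure.measurable_of_measurable_coe _ fun A hA => ?_
    simp only [stepMeasure, Measure.coe_add, Pi.add_apply, Measure.smul_apply, smul_eq_mul]
    have h2 : Measurable fun z : ℝ × S × M => ((ENNReal.ofReal z.1, z.2) : Entry S M) := by
      fun_prop
    refine Measurable.add ?_ (Measurable.mul ?_ ?_)
    · exact (Measure.measurable_coe hA).comp ((Measure.measurable_map _ h2).comp h1)
    · exact measurable_const.sub ((Measure.measurable_coe MeasurableSet.univ).comp h1)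
    · have h3 : Measurable fun h : Hist S M n => ((∞, (Hist.last h).2) : Entry S M) :=
        measurable_const.prodMk (measurable_last n).snd
      exact (Measure.measurable_coe hA).comp (Measure.measurable_dirac.comp h3)

instance (σ : Scheduler C x M) (n : ℕ) : IsMarkovKernel (σ.stepKernel n) where
  isProbabilityMeasure h := by
    refine ⟨?_⟩
    have h2 : Measurable fun z : ℝ × S × M => ((ENNReal.ofReal z.1, z.2) : Entry S M) := by
      fun_prop
    change σ.stepMeasure n h Set.univ = 1
    simp only [stepMeasure, Measure.coe_add, Pi.add_apply, Measure.smul_apply, smul_eq_mul]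
    rw [Measure.map_apply h2 MeasurableSet.univ, Set.preimage_univ,
      measure_univ (μ := Measure.dirac _), mul_one,
      add_tsub_cancel_of_le (σ.jumpMeasure_univ_le_one n h)]

/-- The probability measure on infinite runs from the initial state `s` under the scheduler. -/
def runMeasure (σ : Scheduler C x M) (s : S) : Measure (ℕ → Entry S M) :=
  Kernel.trajMeasure (X := fun _ => Entry S M)
    (σ.init.toMeasure.map fun m => ((0, s, m) : Entry S M)) σ.stepKernel

end Scheduler

/-- The runs that visit a goal state within `T` time units. -/
def reach (M : Type*) (G : Set S) (T : ℝ) : Set (ℕ → Entry S M) :=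
  {ω | ∃ n, (ω n).2.1 ∈ G ∧ ∑ i ∈ Finset.range (n + 1), (ω i).1 ≤ ENNReal.ofReal T}

/-- The probability to reach `G` within time `T` from `s`. -/
def reachProb [DiscreteMeasurableSpace S] [Countable M] [DiscreteMeasurableSpace M]
    {C : CTMDP S Act} {x : Timing} (σ : Scheduler C x M) (G : Set S) (T : ℝ) (s : S) : ℝ :=
  (σ.runMeasure s).real (reach M G T)

/-- The value of time-bounded reachability: the supremum over the timed schedulers of class `x`. -/
def value [DiscreteMeasurableSpace S] (C : CTMDP S Act) (x : Timing) (G : Set S) (T : ℝ)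
    (s : S) : ℝ :=
  ⨆ σ : TimedScheduler C x, reachProb σ G T s

end Scheduler

section StochasticUpdate

variable {S Act : Type*}

/-- A timed stochastic-update scheduler `(M, σ_u, π₀)` of class `x`, for a countable set `M`: the
initial memory element is drawn from `init`; given the current memory element, the state and the
time `t ≥ 0` spent there, `update` is a distribution over the action and the new memory element. -/
structure StochasticUpdate (C : CTMDP S Act) (x : Timing) (M : Type*) [Countable M] where
  init : PMF M
  update : M → S → ℝ → PMF (Act × M)
  measurable_update : ∀ m s q, Measurable fun t => update m s t q
  update_enabled : ∀ m s t a m', a ∉ C.enabled s → update m s t (a, m') = 0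
  update_early : x = .early → ∀ m s t t', 0 ≤ t → 0 ≤ t' →
    (update m s t).map Prod.fst = (update m s t').map Prod.fst

/-- A stochastic-update scheduler controls the process through the current memory and state. -/
def StochasticUpdate.toScheduler [Finite S] [MeasurableSpace S] [DiscreteMeasurableSpace S]
    {C : CTMDP S Act} {x : Timing} {M : Type*} [Countable M] [MeasurableSpace M]
    [DiscreteMeasurableSpace M] (σ : StochasticUpdate C x M) : Scheduler C x M where
  init := σ.init
  decision n h t := σ.update (Hist.last h).2.2 (Hist.last h).2.1 t
  measurable_decision n q := by
    have h1 : Measurable fun y : ℝ × (S × M) => σ.update y.2.2 y.2.1 y.1 q :=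
      measurable_from_prod_countable_left fun z => σ.measurable_update z.2 z.1 q
    have h2 : Measurable fun z : Hist S M n × ℝ => (z.2, (Hist.last z.1).2) :=
      measurable_snd.prodMk ((measurable_pi_apply _).comp measurable_fst).snd
    exact h1.comp h2
  decision_enabled n h t a m' := σ.update_enabled _ _ t a m'
  decision_early hx n h t t' := σ.update_early hx _ _ t t'

end StochasticUpdate

section Counting

/-- Unnormalised probability that a pure birth process with the rates `r 0, r 1, …` of simulated
loops makes `n` of them in time `t`, where in addition each phase `i` is killed at rate `l - r i`
(the common factor `exp (-l t)` is left out). -/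
def loopWeight (r : ℕ → ℝ) (t : ℝ) (n : ℕ) : ℝ≥0∞ :=
  ENNReal.ofReal (t ^ n / n ! * ∏ i ∈ Finset.range n, r i)

theorem loopWeight_tsum_ne_zero (r : ℕ → ℝ) (t : ℝ) : ∑' n, loopWeight r t n ≠ 0 := by
  intro h
  have := ENNReal.tsum_eq_zero.1 h 0
  simp [loopWeight] at this

theorem loopWeight_tsum_ne_top {r : ℕ → ℝ} {l : ℝ} (h0 : ∀ i, 0 ≤ r i) (hl : ∀ i, r i ≤ l)
    (t : ℝ) : ∑' n, loopWeight r t n ≠ ∞ := by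
  have h1 : ∀ n, loopWeight r t n ≤ ENNReal.ofReal ((|t| * l) ^ n / n !) := by
    intro n
    refine ENNReal.ofReal_le_ofReal ?_
    have h2 : ∏ i ∈ Finset.range n, r i ≤ l ^ n := by
      simpa using Finset.prod_le_prod (s := Finset.range n) (fun i _ => h0 i) (fun i _ => hl i)
    have h3 : 0 ≤ ∏ i ∈ Finset.range n, r i := Finset.prod_nonneg fun i _ => h0 i
    have h4 : t ^ n ≤ |t| ^ n := by
      rw [← abs_pow]; exact le_abs_self _
    rw [mul_pow, mul_div_right_comm]
    gcongr
  refine ne_top_of_le_ne_top ?_ (ENNReal.tsum_le_tsum h1)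
  exact (Real.summable_pow_div_factorial (|t| * l)).tsum_ofReal_ne_top

variable {S Act : Type*} [Fintype S]

/-- Rate of the simulated self-loops in `s` after `i` of them, where `m` transitions of the
uniformised model were counted on entry to `s`. A late scheduler updates its action after
every simulated transition; an early scheduler keeps the action chosen on entry. -/
def loopRate (C : CTMDP S Act) (x : Timing) (l : ℝ) (d : ℕ → (s : S) → C.enabled s)
    (m : ℕ) (s : S) (i : ℕ) : ℝ :=
  match x with
  | .late => l - C.exit s (d (m + i) s)
  | .early => l - C.exit s (d m s)

theorem loopRate_le (C : CTMDP S Act) (x : Timing) {l : ℝ}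
    (d : ℕ → (s : S) → C.enabled s) (m : ℕ) (s : S) (i : ℕ) : C.loopRate x l d m s i ≤ l := by
  cases x
  · simpa [loopRate] using C.exit_nonneg _ _
  · simpa [loopRate] using C.exit_nonneg _ _

variable [Fintype Act]

theorem loopRate_nonneg (C : CTMDP S Act) (x : Timing) {l : ℝ} (hl : C.maxExit ≤ l)
    (d : ℕ → (s : S) → C.enabled s) (m : ℕ) (s : S) (i : ℕ) : 0 ≤ C.loopRate x l d m s i := by
  cases x
  · simpa [loopRate] using (C.exit_le_maxExit _ _).trans hl
  · simpa [loopRate] using (C.exit_le_maxExit _ _).trans hl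

/-- Distribution of the number of simulated self-loops during the first `t` time units in `s`,
given that `s` has not been left. -/
def loopCount (C : CTMDP S Act) (x : Timing) (l : ℝ) (hl : C.maxExit ≤ l)
    (d : ℕ → (s : S) → C.enabled s) (m : ℕ) (s : S) (t : ℝ) : PMF ℕ :=
  PMF.normalize (loopWeight (C.loopRate x l d m s) t) (loopWeight_tsum_ne_zero _ t)
    (loopWeight_tsum_ne_top (C.loopRate_nonneg x hl d m s) (C.loopRate_le x d m s) t)

/-- The action taken in `s` after `n` simulated self-loops. -/
def simAction (C : CTMDP S Act) (x : Timing) (d : ℕ → (s : S) → C.enabled s) (m : ℕ) (s : S)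
    (n : ℕ) : Act :=
  match x with
  | .late => d (m + n) s
  | .early => d m s

/-- The stochastic-update scheduler on the original model that plays the step-counting scheduler
`d` of the uniformisation to rate `l`. Its memory is the total number of transitions of the
uniformised model so far: the simulated self-loops, whose number `n` in the current state is
drawn at random, and the actual transitions. -/
def countScheduler (C : CTMDP S Act) (x : Timing) (l : ℝ) (hl : C.maxExit ≤ l)
    (d : ℕ → (s : S) → C.enabled s) : StochasticUpdate C x ℕ where
  init := PMF.pure 0
  update m s t := (C.loopCount x l hl d m s t).map fun n => (C.simAction x d m s n, m + n + 1)
  measurable_update m s q := by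
    classical
    simp only [PMF.map_apply, loopCount, PMF.normalize_apply]
    have h1 : ∀ n, Measurable fun t => loopWeight (C.loopRate x l d m s) t n := by
      intro n
      unfold loopWeight
      fun_prop
    refine Measurable.tsum fun n => ?_
    split_ifs
    · exact (h1 n).mul (Measurable.tsum h1).inv
    · exact measurable_const
  update_enabled m s t a m' ha := by
    classical
    rw [PMF.map_apply, ENNReal.tsum_eq_zero]
    intro n
    rw [if_neg]
    rintro h
    have h1 : a = C.simAction x d m s n := congrArg Prod.fst h
    apply ha
    rw [h1]
    cases x
    · exact (d (m + n) s).2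
    · exact (d m s).2
  update_early hx m s t t' _ _ := by
    subst hx
    simp only [PMF.map_comp]
    have : (Prod.fst ∘ fun n => (C.simAction .early d m s n, m + n + 1)) =
        Function.const ℕ ((d m s : Act)) := rfl
    rw [this, PMF.map_const, PMF.map_const]

end Counting

end CTMDP

end

/-!
The value of a policy in the uniformised model can be compared with the value in `C` without any
coupling of the two processes: both bounds of the algorithm are turned into functions of the
remaining time that satisfy the differential inequality of a dynamic programming equation of `C`.
Integrated along one sojourn, the inequality says that the conditional probability to reach the goal
in time, estimated by that function, is a super- or a submartingale along the jumps of the controlled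
process (`Scheduler.runMeasure_reach_le`, `Scheduler.le_runMeasure_reach`).

* *Upper bound.* For the Poisson weights `ψ_t(i)` of the time horizon `t`, `upperFn` is
  `1 - ∑_{i < N} ψ_t(i) (1 - w_i)`, where `w_i` is the maximal probability to reach the goal within
  `i` steps of the uniformised model. As `w_{i+1}` dominates the average of `w_i` over the
  successors for every action, `sum_rate_upperFn_le` holds, and the chain rule for
  `exp (-hazard) * upperFn`, which is absolutely continuous (`lintegral_hazard_le`), turns it into the
  supermartingale property for arbitrary schedulers. At time `T` the function exceeds the computed
  upper bound by the Poisson tail from `N` on, which is at most `ε κ`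
  (`one_sub_sum_pois_truncation_le`).

* *Lower bound.* The computed lower bound is `∑_{i < N} ψ_T(i) q_i`, where `q_i` is the probability
  that the greedy step-counting scheduler reaches the goal within `i` steps
  (`lowerFn_eq_lowerVal`). In `C` a sojourn under the counting scheduler is a chain of phases, one for
  each number of simulated self-loops. The normalising constant of the loop count is a power series
  `Z` whose logarithmic derivative is `l` minus the expected exit rate, so `exp (-hazard)` is equal to
  `exp (-l t) Z(t)` (`exp_neg_hazard_countScheduler`) and cancels it: a jump after `j` loops has the
  same density as in the uniformised model. The backward equation (`hasDerivAt_lowerFn`) summed over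
  the phases (`eq_integral_phaseProb`) gives the submartingale property.

* *Termination.* One more step increases the maximal reachability probability by at most
  `maxExit / l`, the largest probability to enter the goal in one step (`reachRem_succ_le_add`), and
  the scheduler that is optimal for `n` steps is good for all larger step numbers (`le_lowerRem`).
  The Poisson distribution with mean `r = l T` is concentrated around `r`, so with `n` a little below
  `r` the two bounds differ by a quantity that vanishes as `l` grows (`sum_pois_gap_le`).
-/

namespace CTMDP

/-! ### One step of the controlled process -/

section Runs

variable {S Act M : Type*} [Fintype S] [Fintype Act] [MeasurableSpace S]
  [DiscreteMeasurableSpace S] [Countable M] [MeasurableSpace M] [DiscreteMeasurableSpace M]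
  {C : CTMDP S Act} {x : Timing}

theorem Scheduler.lintegral_stepMeasure (σ : Scheduler C x M) (n : ℕ) (h : Hist S M n)
    {f : Entry S M → ℝ≥0∞} (hf : Measurable f) :
    ∫⁻ e, f e ∂σ.stepMeasure n h =
      (∫⁻ r in Set.Ioi (0 : ℝ), ∑' z : S × M,
        C.jumpDensity x (Hist.last h).2.1 (σ.decision n h) r z.1 z.2 *
          f (ENNReal.ofReal r, z)) +
      (1 - σ.jumpMeasure n h Set.univ) * f (∞, (Hist.last h).2) := by
  have h2 : Measurable fun z : ℝ × S × M => ((ENNReal.ofReal z.1, z.2) : Entry S M) := by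
    fun_prop
  have hm : Measurable fun z : ℝ × S × M =>
      C.jumpDensity x (Hist.last h).2.1 (σ.decision n h) z.1 z.2.1 z.2.2 :=
    (σ.measurable_jumpDensity n).comp measurable_prodMk_left
  have hf2 : Measurable fun z : ℝ × S × M => f (ENNReal.ofReal z.1, z.2) := hf.comp h2
  rw [stepMeasure, lintegral_add_measure, lintegral_smul_measure, lintegral_dirac' _ hf,
    lintegral_map hf h2, jumpMeasure, lintegral_withDensity_eq_lintegral_mul _ hm hf2,
    lintegral_prod _ (hm.mul hf2).aemeasurable]
  simp only [lintegral_count, smul_eq_mul, Pi.mul_apply]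

/-- Integration of a function of the first `n + 2` entries of a run: the last of them is
integrated against the step law that belongs to the preceding ones. -/
theorem Scheduler.lintegral_runMeasure_succ (σ : Scheduler C x M) (s : S) (n : ℕ)
    {F : (ℕ → Entry S M) → ℝ≥0∞} (hF : Measurable F) (hd : DependsOn F (Set.Iic (n + 1))) :
    ∫⁻ ω, F ω ∂σ.runMeasure s =
      ∫⁻ ω, ∫⁻ e, F (Function.update ω (n + 1) e)
        ∂σ.stepMeasure n (Preorder.frestrictLe n ω) ∂σ.runMeasure s := by
  let ext : Hist S M n × Entry S M → (ℕ → Entry S M) := fun p i =>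
    if h : i ≤ n then p.1 ⟨i, Finset.mem_Iic.2 h⟩ else p.2
  have hext : Measurable ext := by
    refine measurable_pi_lambda _ fun i => ?_
    by_cases h : i ≤ n
    · simp only [ext, h, dite_true]; fun_prop
    · simp only [ext, h, dite_false]; fun_prop
  have hFe : Measurable fun p => F (ext p) := hF.comp hext
  have hprob : IsProbabilityMeasure (σ.init.toMeasure.map fun m => ((0, s, m) : Entry S M)) :=
    Measure.isProbabilityMeasure_map (Measurable.of_discrete).aemeasurable
  have key := Kernel.map_frestrictLe_trajMeasure_compProd_eq_map_trajMeasure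
    (X := fun _ => Entry S M) (μ₀ := σ.init.toMeasure.map fun m => ((0, s, m) : Entry S M))
    (κ := σ.stepKernel) (a := n)
  have hrm : IsProbabilityMeasure (σ.runMeasure s) := by
    unfold runMeasure; infer_instance
  have e1 : ∀ ω : ℕ → Entry S M, F ω = F (ext (Preorder.frestrictLe n ω, ω (n + 1))) := by
    intro ω
    refine hd fun i hi => ?_
    by_cases h : i ≤ n
    · simp [ext, h]
    · have : i = n + 1 := le_antisymm hi (by omega)
      subst this
      simp [ext]
  have e2 : ∀ (ω : ℕ → Entry S M) e,
      F (ext (Preorder.frestrictLe n ω, e)) = F (Function.update ω (n + 1) e) := by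
    intro ω e
    refine hd fun i hi => ?_
    by_cases h : i ≤ n
    · have : i ≠ n + 1 := by omega
      simp [ext, h, this]
    · have : i = n + 1 := le_antisymm hi (by omega)
      subst this
      simp [ext]
  have hm : Measurable fun ω : ℕ → Entry S M => (Preorder.frestrictLe n ω, ω (n + 1)) := by
    fun_prop
  calc ∫⁻ ω, F ω ∂σ.runMeasure s
      = ∫⁻ ω, F (ext (Preorder.frestrictLe n ω, ω (n + 1))) ∂σ.runMeasure s := by
        simp only [← e1]
    _ = ∫⁻ p, F (ext p) ∂((σ.runMeasure s).map
          fun ω => (Preorder.frestrictLe n ω, ω (n + 1))) := by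
        rw [lintegral_map hFe hm]
    _ = ∫⁻ p, F (ext p) ∂(((σ.runMeasure s).map (Preorder.frestrictLe n)) ⊗ₘ σ.stepKernel n) := by
        rw [runMeasure, key]
    _ = _ := by
        have hfl : Measurable (Preorder.frestrictLe (π := fun _ => Entry S M) n) := by fun_prop
        have : IsProbabilityMeasure ((σ.runMeasure s).map (Preorder.frestrictLe n)) :=
          Measure.isProbabilityMeasure_map hfl.aemeasurable
        rw [Measure.lintegral_compProd hFe, lintegral_map _ hfl]
        · simp only [e2]; rfl
        · exact Measurable.lintegral_kernel_prod_right' hFe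

theorem Scheduler.lintegral_runMeasure_zero (σ : Scheduler C x M) (s : S)
    {f : Entry S M → ℝ≥0∞} (hf : Measurable f) :
    ∫⁻ ω, f (ω 0) ∂σ.runMeasure s = ∫⁻ m, f (0, s, m) ∂σ.init.toMeasure := by
  have h0 : (σ.runMeasure s).map (fun ω => ω 0) =
      σ.init.toMeasure.map fun m => ((0, s, m) : Entry S M) := by
    let e : (Hist S M 0) → Entry S M := fun h => h ⟨0, Finset.mem_Iic.2 le_rfl⟩
    have he : Measurable e := measurable_pi_apply _
    have hfl : Measurable (Preorder.frestrictLe (π := fun _ => Entry S M) 0) := by fun_prop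
    have : (fun ω : ℕ → Entry S M => ω 0) = e ∘ Preorder.frestrictLe 0 := rfl
    rw [this, ← Measure.map_map he hfl, runMeasure, Kernel.trajMeasure,
      Measure.map_comp _ _ hfl, Kernel.traj_map_frestrictLe, Kernel.partialTraj_self,
      Measure.id_comp, Measure.map_map he (by fun_prop)]
    exact Measure.map_id
  have hm : Measurable fun m : M => ((0, s, m) : Entry S M) := Measurable.of_discrete
  rw [← lintegral_map hf hm, ← h0, lintegral_map hf (measurable_pi_apply 0)]

/-- The time of the `n`-th jump. -/
noncomputable def elapsed (ω : ℕ → Entry S M) (n : ℕ) : ℝ≥0∞ := ∑ i ∈ Finset.range (n + 1), (ω i).1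

/-- The runs that visit a goal state within `T` time units and `n` jumps. -/
def reachBy (M : Type*) (G : Set S) (T : ℝ) (n : ℕ) : Set (ℕ → Entry S M) :=
  {ω | ∃ k ≤ n, (ω k).2.1 ∈ G ∧ elapsed ω k ≤ ENNReal.ofReal T}

open Classical in
/-- The estimate, after `n` jumps, of the conditional probability to reach `G` within time `T`:
it is `1` if this has happened already, `0` if the time is over, and given by `V` (a function
of the number of jumps, the current state and memory, and the remaining time) otherwise. -/
noncomputable def potential (G : Set S) (T : ℝ) (V : ℕ → S × M → ℝ → ℝ≥0∞) (n : ℕ) (ω : ℕ → Entry S M) : ℝ≥0∞ :=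
  if ω ∈ reachBy M G T n then 1
  else if elapsed ω n ≤ ENNReal.ofReal T then V n (ω n).2 (T - (elapsed ω n).toReal)
  else 0

omit [Fintype S] [DiscreteMeasurableSpace S] [Countable M] [DiscreteMeasurableSpace M] in
theorem measurable_elapsed (n : ℕ) : Measurable fun ω : ℕ → Entry S M => elapsed ω n := by
  unfold elapsed; fun_prop

omit [Fintype S] [Countable M] [DiscreteMeasurableSpace M] in
theorem measurableSet_reachBy (G : Set S) (T : ℝ) (n : ℕ) :
    MeasurableSet (reachBy M G T n) := by
  have : reachBy M G T n = ⋃ k ∈ Set.Iic n,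
      ((fun ω : ℕ → Entry S M => (ω k).2.1) ⁻¹' G ∩
        {ω | elapsed ω k ≤ ENNReal.ofReal T}) := by
    ext ω; simp [reachBy, and_left_comm]
  rw [this]
  refine MeasurableSet.biUnion (Set.to_countable _) fun k _ => ?_
  exact ((measurable_pi_apply k).snd.fst (MeasurableSet.of_discrete)).inter
    (measurableSet_le (measurable_elapsed k) measurable_const)

theorem measurable_potential (G : Set S) (T : ℝ) {V : ℕ → S × M → ℝ → ℝ≥0∞}
    (hV : ∀ n z, Measurable (V n z)) (n : ℕ) : Measurable (potential G T V n) := by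
  refine Measurable.ite (measurableSet_reachBy G T n) measurable_const ?_
  refine Measurable.ite (measurableSet_le (measurable_elapsed n) measurable_const) ?_
    measurable_const
  have h1 : Measurable fun y : ℝ × (S × M) => V n y.2 y.1 :=
    measurable_from_prod_countable_left fun z => hV n z
  exact h1.comp ((measurable_const.sub (measurable_elapsed n).ennreal_toReal).prodMk
    (measurable_pi_apply n).snd)

omit [Fintype S] [MeasurableSpace S] [DiscreteMeasurableSpace S] [Countable M] [MeasurableSpace M]
  [DiscreteMeasurableSpace M] in
theorem elapsed_update_of_le (ω : ℕ → Entry S M) {k n : ℕ} (h : k ≤ n) (e : Entry S M) :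
    elapsed (Function.update ω (n + 1) e) k = elapsed ω k := by
  refine Finset.sum_congr rfl fun i hi => ?_
  rw [Function.update_of_ne]
  have := Finset.mem_range.1 hi
  omega

omit [Fintype S] [MeasurableSpace S] [DiscreteMeasurableSpace S] [Countable M] [MeasurableSpace M]
  [DiscreteMeasurableSpace M] in
theorem elapsed_update_succ (ω : ℕ → Entry S M) (n : ℕ) (e : Entry S M) :
    elapsed (Function.update ω (n + 1) e) (n + 1) = elapsed ω n + e.1 := by
  rw [← elapsed_update_of_le ω le_rfl e, elapsed, Finset.sum_range_succ, ← elapsed,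
    Function.update_self]

omit [Fintype S] [MeasurableSpace S] [DiscreteMeasurableSpace S] [Countable M] [MeasurableSpace M]
  [DiscreteMeasurableSpace M] in
theorem update_mem_reachBy_succ (G : Set S) (T : ℝ) (ω : ℕ → Entry S M) (n : ℕ) (e : Entry S M) :
    Function.update ω (n + 1) e ∈ reachBy M G T (n + 1) ↔
      ω ∈ reachBy M G T n ∨ (e.2.1 ∈ G ∧ elapsed ω n + e.1 ≤ ENNReal.ofReal T) := by
  constructor
  · rintro ⟨k, hk, h1, h2⟩
    rcases Nat.of_le_succ hk with h | rfl
    · left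
      rw [Function.update_of_ne (by omega)] at h1
      rw [elapsed_update_of_le ω h] at h2
      exact ⟨k, h, h1, h2⟩
    · right
      rw [Function.update_self] at h1
      rw [elapsed_update_succ] at h2
      exact ⟨h1, h2⟩
  · rintro (⟨k, hk, h1, h2⟩ | ⟨h1, h2⟩)
    · refine ⟨k, by omega, ?_, ?_⟩
      · rwa [Function.update_of_ne (by omega)]
      · rwa [elapsed_update_of_le ω hk]
    · refine ⟨n + 1, le_rfl, ?_, ?_⟩
      · rwa [Function.update_self]
      · rwa [elapsed_update_succ]

omit [Fintype S] [MeasurableSpace S] [DiscreteMeasurableSpace S] [Countable M] [MeasurableSpace M]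
  [DiscreteMeasurableSpace M] in
theorem dependsOn_potential (G : Set S) (T : ℝ) (V : ℕ → S × M → ℝ → ℝ≥0∞) (n : ℕ) :
    DependsOn (potential G T V n) (Set.Iic n) := by
  intro ω ω' h
  have he : ∀ k ≤ n, elapsed ω k = elapsed ω' k := fun k hk =>
    Finset.sum_congr rfl fun i hi => by
      rw [h i (by have := Finset.mem_range.1 hi; simp; omega)]
  have hr : ω ∈ reachBy M G T n ↔ ω' ∈ reachBy M G T n := by
    refine exists_congr fun k => and_congr_right fun hk => ?_
    rw [h k hk, he k hk]
  by_cases hw : ω' ∈ reachBy M G T n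
  · rw [potential, potential, if_pos hw, if_pos (hr.2 hw)]
  · rw [potential, potential, if_neg hw, if_neg (mt hr.1 hw), he n le_rfl,
      h n (Set.mem_Iic.2 le_rfl)]

open Classical in
/-- The expected potential after the next jump, as long as the goal has not been reached and
time is left. -/
theorem Scheduler.lintegral_potential_update (σ : Scheduler C x M) (G : Set S) (T : ℝ)
    {V : ℕ → S × M → ℝ → ℝ≥0∞} (hV : ∀ n z, Measurable (V n z)) (n : ℕ) (ω : ℕ → Entry S M)
    (h1 : ω ∉ reachBy M G T n) (h2 : elapsed ω n ≤ ENNReal.ofReal T) (hT : 0 ≤ T) :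
    ∫⁻ e, potential G T V (n + 1) (Function.update ω (n + 1) e)
        ∂σ.stepMeasure n (Preorder.frestrictLe n ω) =
      ∫⁻ r in Set.Ioc 0 (T - (elapsed ω n).toReal), ∑' z : S × M,
        C.jumpDensity x (ω n).2.1 (σ.decision n (Preorder.frestrictLe n ω)) r z.1 z.2 *
          if z.1 ∈ G then 1 else V (n + 1) z (T - (elapsed ω n).toReal - r) := by
  have hm : Measurable fun e => potential G T V (n + 1) (Function.update ω (n + 1) e) :=
    (measurable_potential G T hV (n + 1)).comp (measurable_update ω)
  have hfin : elapsed ω n ≠ ∞ := ne_top_of_le_ne_top ENNReal.ofReal_ne_top h2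
  have hle : (elapsed ω n).toReal ≤ T := ENNReal.toReal_le_of_le_ofReal hT h2
  have hval : ∀ e : Entry S M, potential G T V (n + 1) (Function.update ω (n + 1) e) =
      if elapsed ω n + e.1 ≤ ENNReal.ofReal T then
        if e.2.1 ∈ G then 1 else V (n + 1) e.2 (T - (elapsed ω n + e.1).toReal) else 0 := by
    intro e
    simp only [potential, update_mem_reachBy_succ, h1, false_or, elapsed_update_succ,
      Function.update_self]
    by_cases ha : elapsed ω n + e.1 ≤ ENNReal.ofReal T
    · by_cases hb : e.2.1 ∈ G <;> simp [ha, hb]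
    · simp [ha]
  rw [σ.lintegral_stepMeasure n _ hm]
  have htop : potential G T V (n + 1)
      (Function.update ω (n + 1) (∞, (Hist.last (Preorder.frestrictLe n ω)).2)) = 0 := by
    rw [hval]; simp
  rw [htop, mul_zero, add_zero]
  have hset : Set.Ioc 0 (T - (elapsed ω n).toReal) =
      Set.Ioi 0 ∩ Set.Iic (T - (elapsed ω n).toReal) := rfl
  rw [hset, Set.inter_comm, ← Measure.restrict_restrict measurableSet_Iic,
    ← lintegral_indicator measurableSet_Iic]
  refine setLIntegral_congr_fun measurableSet_Ioi fun r hr => ?_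
  have hr0 : 0 < r := hr
  have hcond : elapsed ω n + ENNReal.ofReal r ≤ ENNReal.ofReal T ↔
      r ≤ T - (elapsed ω n).toReal := by
    conv_lhs => rw [← ENNReal.ofReal_toReal hfin]
    rw [← ENNReal.ofReal_add ENNReal.toReal_nonneg hr0.le, ENNReal.ofReal_le_ofReal_iff hT]
    constructor <;> intro h <;> linarith
  simp only [hval]
  by_cases hb : r ≤ T - (elapsed ω n).toReal
  · rw [Set.indicator_of_mem (Set.mem_Iic.2 hb)]
    simp only [hcond, hb, if_true]
    rw [ENNReal.toReal_add hfin ENNReal.ofReal_ne_top, ENNReal.toReal_ofReal hr0.le, sub_add_eq_sub_sub]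
    rfl
  · rw [Set.indicator_of_notMem (by simpa using hb)]
    simp only [hcond, hb, if_false, mul_zero, tsum_zero]

theorem Scheduler.isProbabilityMeasure_runMeasure (σ : Scheduler C x M) (s : S) :
    IsProbabilityMeasure (σ.runMeasure s) := by
  have hprob : IsProbabilityMeasure (σ.init.toMeasure.map fun m => ((0, s, m) : Entry S M)) :=
    Measure.isProbabilityMeasure_map (Measurable.of_discrete).aemeasurable
  unfold runMeasure; infer_instance

/-- A family `V` that starts with `1` on the goal and cannot increase in expectation at a jump
bounds the reachability probability from above. -/
theorem Scheduler.runMeasure_reach_le (σ : Scheduler C x M) (G : Set S) {T : ℝ} (hT : 0 ≤ T)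
    {V : S → ℝ → ℝ≥0∞} (hV : ∀ s, Measurable (V s)) (hG : ∀ s ∈ G, ∀ t, V s t = 1)
    (hstep : ∀ n (h : Hist S M n), (Hist.last h).2.1 ∉ G → ∀ t, 0 ≤ t →
      ∫⁻ r in Set.Ioc 0 t, ∑' z : S × M,
        C.jumpDensity x (Hist.last h).2.1 (σ.decision n h) r z.1 z.2 * V z.1 (t - r)
        ≤ V (Hist.last h).2.1 t) (s : S) :
    σ.runMeasure s (reach M G T) ≤ V s T := by
  classical
  let W : ℕ → S × M → ℝ → ℝ≥0∞ := fun _ z t => V z.1 t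
  have hW : ∀ n z, Measurable (W n z) := fun n z => hV z.1
  have hrp := σ.isProbabilityMeasure_runMeasure s
  have hdec : ∀ n, ∫⁻ ω, potential G T W (n + 1) ω ∂σ.runMeasure s ≤
      ∫⁻ ω, potential G T W n ω ∂σ.runMeasure s := by
    intro n
    rw [σ.lintegral_runMeasure_succ s n (measurable_potential G T hW (n + 1))
      (dependsOn_potential G T W (n + 1))]
    refine lintegral_mono fun ω => ?_
    have hsp : IsProbabilityMeasure (σ.stepMeasure n (Preorder.frestrictLe n ω)) :=
      inferInstanceAs (IsProbabilityMeasure (σ.stepKernel n (Preorder.frestrictLe n ω)))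
    by_cases h1 : ω ∈ reachBy M G T n
    · have : ∀ e, potential G T W (n + 1) (Function.update ω (n + 1) e) = 1 := fun e => by
        rw [potential, if_pos ((update_mem_reachBy_succ G T ω n e).2 (Or.inl h1))]
      simp only [this, lintegral_const, measure_univ, mul_one]
      rw [potential, if_pos h1]
    · by_cases h2 : elapsed ω n ≤ ENNReal.ofReal T
      · rw [σ.lintegral_potential_update G T hW n ω h1 h2 hT, potential, if_neg h1, if_pos h2]
        have hng : (ω n).2.1 ∉ G := fun h => h1 ⟨n, le_rfl, h, h2⟩
        refine le_trans (le_of_eq ?_) (hstep n (Preorder.frestrictLe n ω) hng _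
          (sub_nonneg.2 (ENNReal.toReal_le_of_le_ofReal hT h2)))
        refine lintegral_congr fun r => tsum_congr fun z => ?_
        congr 1
        split_ifs with h
        · rw [hG _ h]
        · rfl
      · have : ∀ e, potential G T W (n + 1) (Function.update ω (n + 1) e) = 0 := fun e => by
          have h3 : ¬ elapsed ω n + e.1 ≤ ENNReal.ofReal T := fun h => h2 (le_self_add.trans h)
          rw [potential, if_neg, if_neg]
          · rwa [elapsed_update_succ]
          · rw [update_mem_reachBy_succ]
            tauto
        simp [this]
  have hdec' : ∀ n, ∫⁻ ω, potential G T W n ω ∂σ.runMeasure s ≤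
      ∫⁻ ω, potential G T W 0 ω ∂σ.runMeasure s := fun n => by
    induction n with
    | zero => exact le_rfl
    | succ n ih => exact (hdec n).trans ih
  have h0 : ∫⁻ ω, potential G T W 0 ω ∂σ.runMeasure s = V s T := by
    have : ∀ ω : ℕ → Entry S M, potential G T W 0 ω =
        if (ω 0).1 ≤ ENNReal.ofReal T then V (ω 0).2.1 (T - (ω 0).1.toReal) else 0 := by
      intro ω
      by_cases hb : (ω 0).1 ≤ ENNReal.ofReal T
      · by_cases hg : (ω 0).2.1 ∈ G
        · simp [potential, reachBy, elapsed, hb, hg, hG _ hg]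
        · simp [potential, reachBy, elapsed, hb, hg, W]
      · simp [potential, reachBy, elapsed, hb]
    simp only [this]
    rw [σ.lintegral_runMeasure_zero s (f := fun e : Entry S M =>
      if e.1 ≤ ENNReal.ofReal T then V e.2.1 (T - e.1.toReal) else 0)]
    · simp
    · refine Measurable.ite (measurableSet_le measurable_fst measurable_const) ?_ measurable_const
      have h1 : Measurable fun y : ℝ × S => V y.2 y.1 :=
        measurable_from_prod_countable_left fun z => hV z
      exact h1.comp (by fun_prop : Measurable fun e : Entry S M => (T - e.1.toReal, e.2.1))
  have hun : reach M G T = ⋃ n, reachBy M G T n := by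
    ext ω
    simp only [reach, reachBy, elapsed, Set.mem_iUnion, Set.mem_ofPred_eq]
    constructor
    · rintro ⟨n, h⟩
      exact ⟨n, n, le_rfl, h⟩
    · rintro ⟨n, k, -, h⟩
      exact ⟨k, h⟩
  have hmono : Monotone (reachBy M G T) := fun a b hab ω ⟨k, hk, h⟩ => ⟨k, hk.trans hab, h⟩
  rw [hun, hmono.measure_iUnion]
  refine iSup_le fun n => ?_
  rw [← h0, ← lintegral_indicator_one (measurableSet_reachBy G T n)]
  refine le_trans (lintegral_mono fun ω => ?_) (hdec' n)
  by_cases h1 : ω ∈ reachBy M G T n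
  · simp [h1, potential]
  · simp [h1]

/-- A family `V n` that cannot decrease in expectation at a jump, and that vanishes when the
budget `n` of jumps is used up, bounds the reachability probability from below. -/
theorem Scheduler.le_runMeasure_reach (σ : Scheduler C x M) (G : Set S) {T : ℝ} (hT : 0 ≤ T)
    {V : ℕ → S × M → ℝ → ℝ≥0∞} (hV : ∀ n z, Measurable (V n z)) (h1 : ∀ n z t, 0 ≤ t → V n z t ≤ 1)
    (h0 : ∀ z t, V 0 z t = 0)
    (hstep : ∀ k n (h : Hist S M n), (Hist.last h).2.1 ∉ G → ∀ t, 0 ≤ t →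
      V (k + 1) (Hist.last h).2 t ≤ ∫⁻ r in Set.Ioc 0 t, ∑' z : S × M,
        C.jumpDensity x (Hist.last h).2.1 (σ.decision n h) r z.1 z.2 * V k z (t - r))
    (N : ℕ) (m₀ : M) (hinit : σ.init = PMF.pure m₀) (s : S) :
    V N (s, m₀) T ≤ σ.runMeasure s (reach M G T) := by
  classical
  let W : ℕ → S × M → ℝ → ℝ≥0∞ := fun n => V (N - n)
  have hW : ∀ n z, Measurable (W n z) := fun n z => hV _ z
  have hrp := σ.isProbabilityMeasure_runMeasure s
  have hinc : ∀ n < N, ∫⁻ ω, potential G T W n ω ∂σ.runMeasure s ≤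
      ∫⁻ ω, potential G T W (n + 1) ω ∂σ.runMeasure s := by
    intro n hn
    rw [σ.lintegral_runMeasure_succ s n (measurable_potential G T hW (n + 1))
      (dependsOn_potential G T W (n + 1))]
    refine lintegral_mono fun ω => ?_
    have hsp : IsProbabilityMeasure (σ.stepMeasure n (Preorder.frestrictLe n ω)) :=
      inferInstanceAs (IsProbabilityMeasure (σ.stepKernel n (Preorder.frestrictLe n ω)))
    by_cases hr : ω ∈ reachBy M G T n
    · have : ∀ e, potential G T W (n + 1) (Function.update ω (n + 1) e) = 1 := fun e => by
        rw [potential, if_pos ((update_mem_reachBy_succ G T ω n e).2 (Or.inl hr))]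
      simp only [this, lintegral_const, measure_univ, mul_one]
      rw [potential, if_pos hr]
    · by_cases h2 : elapsed ω n ≤ ENNReal.ofReal T
      · rw [σ.lintegral_potential_update G T hW n ω hr h2 hT, potential, if_neg hr, if_pos h2]
        have hng : (ω n).2.1 ∉ G := fun h => hr ⟨n, le_rfl, h, h2⟩
        have hNn : N - n = (N - (n + 1)) + 1 := by omega
        simp only [W]
        rw [hNn]
        refine (hstep _ n (Preorder.frestrictLe n ω) hng _
          (sub_nonneg.2 (ENNReal.toReal_le_of_le_ofReal hT h2))).trans ?_
        refine setLIntegral_mono_ae' measurableSet_Ioc (ae_of_all _ fun r hr => ?_)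
        refine ENNReal.tsum_le_tsum fun z => ?_
        refine mul_le_mul_right ?_ _
        split_ifs with h
        · exact h1 _ _ _ (sub_nonneg.2 hr.2)
        · exact le_rfl
      · rw [potential, if_neg hr, if_neg h2]
        exact zero_le
  have hinc' : ∀ n ≤ N, ∫⁻ ω, potential G T W 0 ω ∂σ.runMeasure s ≤
      ∫⁻ ω, potential G T W n ω ∂σ.runMeasure s := fun n => by
    induction n with
    | zero => exact fun _ => le_rfl
    | succ n ih => exact fun h => (ih (by omega)).trans (hinc n (by omega))
  have hstart : V N (s, m₀) T ≤ ∫⁻ ω, potential G T W 0 ω ∂σ.runMeasure s := by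
    have hle : ∀ ω : ℕ → Entry S M, (if (ω 0).1 = 0 then V N (ω 0).2 T else 0) ≤
        potential G T W 0 ω := by
      intro ω
      by_cases hb : (ω 0).1 = 0
      · rw [if_pos hb]
        by_cases hg : (ω 0).2.1 ∈ G
        · simpa [potential, reachBy, elapsed, hb, hg] using h1 N (ω 0).2 T hT
        · simp [potential, reachBy, elapsed, hb, hg, W]
      · rw [if_neg hb]
        exact zero_le
    refine le_trans (le_of_eq ?_) (lintegral_mono hle)
    have hf : Measurable fun e : Entry S M => if e.1 = 0 then V N e.2 T else 0 := by
      refine Measurable.ite (measurable_fst (measurableSet_singleton 0)) ?_ measurable_const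
      exact (Measurable.of_discrete (f := fun z : S × M => V N z T)).comp measurable_snd
    rw [σ.lintegral_runMeasure_zero s hf, hinit, PMF.toMeasure_pure,
      lintegral_dirac' _ Measurable.of_discrete]
    simp
  refine (hstart.trans (hinc' N le_rfl)).trans ?_
  have hsub : reachBy M G T N ⊆ reach M G T := fun ω ⟨k, _, h⟩ => ⟨k, h⟩
  refine le_trans ?_ (measure_mono hsub)
  rw [← lintegral_indicator_one (measurableSet_reachBy G T N)]
  refine lintegral_mono fun ω => ?_
  by_cases hr : ω ∈ reachBy M G T N
  · simp [hr, potential]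
  · simp [hr, potential, W, h0]

end Runs

/-! ### Poisson weights -/

section Poisson

theorem pois_nonneg {r : ℝ} (hr : 0 ≤ r) (i : ℕ) : 0 ≤ pois r i := by
  unfold pois; positivity

theorem pois_zero_right (r : ℝ) : pois r 0 = Real.exp (-r) := by simp [pois]

theorem succ_mul_pois_succ (r : ℝ) (i : ℕ) : ((i + 1 : ℕ) : ℝ) * pois r (i + 1) = r * pois r i := by
  unfold pois
  rw [Nat.factorial_succ]
  have h1 : ((i + 1 : ℕ) : ℝ) ≠ 0 := by positivity
  have h2 : ((i ! : ℕ) : ℝ) ≠ 0 := by positivity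
  push_cast at *
  field_simp
  ring

theorem hasSum_pois_mul_pow (r z : ℝ) :
    HasSum (fun i => pois r i * z ^ i) (Real.exp (r * (z - 1))) := by
  convert! (NormedSpace.expSeries_div_hasSum_exp (r * z)).mul_left (Real.exp (-r)) using 1
  · funext i
    rw [pois, mul_pow]; ring
  · rw [← Real.exp_eq_exp_ℝ, ← Real.exp_add]
    ring_nf

theorem hasSum_pois (r : ℝ) : HasSum (pois r) 1 := by
  simpa using hasSum_pois_mul_pow r 1

theorem hasSum_pois_mul_id (r : ℝ) : HasSum (fun i => pois r i * i) r := by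
  rw [← hasSum_nat_add_iff' 1]
  convert! (hasSum_pois r).mul_left r using 1
  · funext i
    rw [← succ_mul_pois_succ]; ring
  · simp

theorem hasSum_pois_mul_sq (r : ℝ) : HasSum (fun i => pois r i * (i : ℝ) ^ 2) (r ^ 2 + r) := by
  rw [← hasSum_nat_add_iff' 1]
  convert! ((hasSum_pois_mul_id r).add (hasSum_pois r)).mul_left r using 1
  · funext i
    have := succ_mul_pois_succ r i
    push_cast at *
    linear_combination ((i : ℝ) + 1) * this
  · simp; ring

theorem hasSum_pois_variance (r : ℝ) : HasSum (fun i => pois r i * ((i : ℝ) - r) ^ 2) r := by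
  convert! ((hasSum_pois_mul_sq r).sub ((hasSum_pois_mul_id r).mul_left (2 * r))).add
    ((hasSum_pois r).mul_left (r ^ 2)) using 1
  · funext i; ring
  · ring

theorem sum_pois_le_one {r : ℝ} (hr : 0 ≤ r) (s : Finset ℕ) : ∑ i ∈ s, pois r i ≤ 1 :=
  sum_le_hasSum s (fun i _ => pois_nonneg hr i) (hasSum_pois r)

/-- The tail bound behind the choice of the truncation point. -/
theorem one_sub_sum_pois_truncation_le {l T ε κ : ℝ} (hlT : 0 ≤ l * T) (hεκ : 0 < ε * κ) :
    1 - ∑ i ∈ Finset.range (truncation l T ε κ), pois (l * T) i ≤ ε * κ := by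
  set N := truncation l T ε κ with hN
  set r := l * T with hr
  have hN1 : r * Real.exp 1 ^ 2 - Real.log (ε * κ) ≤ N := Nat.le_ceil _
  have hs1 : HasSum (fun i => pois r (i + N)) (1 - ∑ i ∈ Finset.range N, pois r i) :=
    (hasSum_nat_add_iff' N).2 (hasSum_pois r)
  have hs2 : HasSum (fun i => Real.exp (-N) * (pois r i * Real.exp 1 ^ i))
      (Real.exp (-N) * Real.exp (r * (Real.exp 1 - 1))) :=
    (hasSum_pois_mul_pow r (Real.exp 1)).mul_left _
  have hs3 := (hasSum_nat_add_iff' N).2 hs2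
  have hnn : 0 ≤ ∑ i ∈ Finset.range N, Real.exp (-N) * (pois r i * Real.exp 1 ^ i) :=
    Finset.sum_nonneg fun i _ => by
      have := pois_nonneg hlT i
      positivity
  have hle : 1 - ∑ i ∈ Finset.range N, pois r i ≤
      Real.exp (-N) * Real.exp (r * (Real.exp 1 - 1)) := by
    refine (hasSum_le (fun i => ?_) hs1 hs3).trans (sub_le_self _ hnn)
    have h0 := pois_nonneg hlT (i + N)
    rw [mul_left_comm]
    refine le_mul_of_one_le_right h0 ?_
    rw [← Real.exp_nat_mul, ← Real.exp_add]
    refine Real.one_le_exp ?_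
    push_cast
    have : (0 : ℝ) ≤ i := i.cast_nonneg
    linarith
  refine hle.trans ?_
  rw [← Real.exp_add, ← Real.exp_log hεκ]
  refine Real.exp_le_exp.2 ?_
  have he : Real.exp 1 ≤ Real.exp 1 ^ 2 := by
    have : 1 ≤ Real.exp 1 := Real.one_le_exp zero_le_one
    nlinarith
  have : r * (Real.exp 1 - 1) ≤ r * Real.exp 1 ^ 2 :=
    mul_le_mul_of_nonneg_left (by linarith) hlT
  linarith

/-- The Poisson average `∑_{i < n} ψ_t(i) c(i)` of a sequence, as a function of the time `t`, for
a Poisson process with rate `l`. -/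
noncomputable def poisSum (l : ℝ) (c : ℕ → ℝ) (n : ℕ) (t : ℝ) : ℝ :=
  ∑ i ∈ Finset.range n, pois (l * t) i * c i

theorem poisSum_nonneg {l t : ℝ} (h : 0 ≤ l * t) {c : ℕ → ℝ} (hc : ∀ i, 0 ≤ c i) (n : ℕ) :
    0 ≤ poisSum l c n t :=
  Finset.sum_nonneg fun i _ => mul_nonneg (pois_nonneg h i) (hc i)

theorem poisSum_le_one {l t : ℝ} (h : 0 ≤ l * t) {c : ℕ → ℝ} (hc : ∀ i, c i ≤ 1) (n : ℕ) :
    poisSum l c n t ≤ 1 :=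
  (Finset.sum_le_sum fun i _ => mul_le_of_le_one_right (pois_nonneg h i) (hc i)).trans
    (sum_pois_le_one h _)

theorem poisSum_mono {l t : ℝ} (h : 0 ≤ l * t) {c : ℕ → ℝ} (hc : ∀ i, 0 ≤ c i) {m n : ℕ}
    (hmn : m ≤ n) : poisSum l c m t ≤ poisSum l c n t :=
  Finset.sum_le_sum_of_subset_of_nonneg (Finset.range_mono hmn)
    fun i _ _ => mul_nonneg (pois_nonneg h i) (hc i)

theorem poisSum_succ_zero (l : ℝ) (c : ℕ → ℝ) (n : ℕ) : poisSum l c (n + 1) 0 = c 0 := by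
  simp [poisSum, Finset.sum_range_succ', pois]

theorem contDiff_poisSum (l : ℝ) (c : ℕ → ℝ) (n : ℕ) : ContDiff ℝ 1 (poisSum l c n) := by
  unfold poisSum pois
  fun_prop

theorem hasDerivAt_pois_zero (l t : ℝ) :
    HasDerivAt (fun t => pois (l * t) 0) (-(l * pois (l * t) 0)) t := by
  simp only [pois_zero_right]
  have h := ((hasDerivAt_id t).const_mul l).neg.exp
  convert! h using 1
  simp; ring

theorem hasDerivAt_pois_succ (l t : ℝ) (i : ℕ) :
    HasDerivAt (fun t => pois (l * t) (i + 1)) (l * (pois (l * t) i - pois (l * t) (i + 1))) t := by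
  have h1 : HasDerivAt (fun t : ℝ => l * t) l t := by
    simpa using (hasDerivAt_id t).const_mul l
  have h2 := (h1.neg.exp.mul (h1.fun_pow (i + 1))).div_const ((i + 1)! : ℝ)
  convert! h2 using 1
  simp only [pois, Pi.neg_apply, Nat.factorial_succ]
  have h3 : ((i ! : ℕ) : ℝ) ≠ 0 := by positivity
  have h4 : ((i : ℝ) + 1) ≠ 0 := by positivity
  push_cast
  field_simp
  ring

theorem hasDerivAt_poisSum (l : ℝ) (c : ℕ → ℝ) (n : ℕ) (t : ℝ) :
    HasDerivAt (poisSum l c (n + 1))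
      (l * (poisSum l (fun i => c (i + 1)) n t - poisSum l c (n + 1) t)) t := by
  induction n with
  | zero =>
    have := (hasDerivAt_pois_zero l t).mul_const (c 0)
    convert! this using 1
    · funext t; simp [poisSum]
    · simp [poisSum]; ring
  | succ n ih =>
    have := ih.add ((hasDerivAt_pois_succ l t n).mul_const (c (n + 1)))
    convert! this using 1
    · funext t
      rw [poisSum, Finset.sum_range_succ]; rfl
    · simp only [poisSum, Finset.sum_range_succ]
      ring

end Poisson

/-! ### Integral inequalities for hazard rates -/

section Hazard

/-- If `e^{-F(r)} g(t - r)`, where `F` is the accumulated hazard, decreases at least with the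
speed `e^{-F(r)} θ(r)`, then the integral of the latter is at most `g t`. -/
theorem lintegral_hazard_le {K t : ℝ} (ht : 0 ≤ t) {η : ℝ → ℝ} (hm : Measurable η)
    (h0 : ∀ r, 0 ≤ η r) (hK : ∀ r, η r ≤ K) {g : ℝ → ℝ} (hg : ContDiff ℝ 1 g) (hg0 : 0 ≤ g 0)
    {θ : ℝ → ℝ} (hθ0 : ∀ r ∈ Set.Ioc 0 t, 0 ≤ θ r)
    (hθ : ∀ r ∈ Set.Ioc 0 t, θ r ≤ deriv g (t - r) + η r * g (t - r)) :
    ∫⁻ r in Set.Ioc 0 t, ENNReal.ofReal (θ r * Real.exp (-∫ u in (0 : ℝ)..r, η u)) ≤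
      ENNReal.ofReal (g t) := by
  have hint : ∀ a b, IntervalIntegrable η volume a b := fun a b => by
    refine (intervalIntegrable_const (c := K)).mono_fun hm.aestronglyMeasurable ?_
    filter_upwards with t
    rw [Real.norm_of_nonneg (h0 t), Real.norm_of_nonneg ((h0 t).trans (hK t))]
    exact hK t
  set F : ℝ → ℝ := fun t => ∫ u in (0 : ℝ)..t, η u with hF
  have hK0 : 0 ≤ K := (h0 0).trans (hK 0)
  have hF0 : ∀ r, 0 ≤ r → 0 ≤ F r := fun r hr =>
    intervalIntegral.integral_nonneg hr fun u _ => h0 u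
  have hFlip : LipschitzOnWith (Real.toNNReal K) F (Set.uIcc 0 t) := by
    refine LipschitzOnWith.of_dist_le_mul fun a _ b _ => ?_
    have : F a - F b = ∫ u in b..a, η u :=
      intervalIntegral.integral_interval_sub_left (hint 0 a) (hint 0 b)
    rw [Real.coe_toNNReal K hK0, Real.dist_eq, Real.dist_eq, this, ← Real.norm_eq_abs]
    refine intervalIntegral.norm_integral_le_of_norm_le_const fun r _ => ?_
    rw [Real.norm_of_nonneg (h0 r)]
    exact hK r
  have hexp : LipschitzOnWith 1 (fun y => Real.exp (-y)) (Set.Ici (0 : ℝ)) := by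
    refine (convex_Ici 0).lipschitzOnWith_of_nnnorm_hasDerivWithin_le
      (f' := fun y => Real.exp (-y) * -1)
      (fun y _ => ((hasDerivAt_id y).neg.exp).hasDerivWithinAt) fun y hy => ?_
    rw [← NNReal.coe_le_coe, coe_nnnorm]
    have : (0 : ℝ) ≤ y := hy
    simp [abs_of_pos (Real.exp_pos _), this]
  have hE : AbsolutelyContinuousOnInterval (fun r => Real.exp (-F r)) 0 t :=
    (hexp.comp hFlip (fun r hr => by
      rw [Set.uIcc_of_le ht] at hr; exact hF0 r hr.1)).absolutelyContinuousOnInterval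
  have hgc : ContDiff ℝ 1 fun r => g (t - r) := hg.comp (contDiff_const.sub contDiff_id)
  obtain ⟨B, hB⟩ := hgc.contDiffOn.exists_lipschitzOnWith (s := Set.uIcc 0 t) one_ne_zero
    (convex_uIcc 0 t) isCompact_uIcc
  have hG : AbsolutelyContinuousOnInterval (fun r => g (t - r)) 0 t :=
    hB.absolutelyContinuousOnInterval
  have hprod := hE.fun_mul hG
  have hftc := hprod.integral_deriv_eq_sub
  have hii := hprod.intervalIntegrable_deriv
  have hloc : LocallyIntegrable η volume := by
    intro t
    refine ⟨Set.Icc (t - 1) (t + 1), Icc_mem_nhds (by linarith) (by linarith), ?_⟩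
    exact (intervalIntegrable_iff_integrableOn_Icc_of_le (by linarith)).1 (hint _ _)
  have hae : ∀ᵐ r, deriv (fun r => Real.exp (-F r) * g (t - r)) r =
      -(Real.exp (-F r) * (deriv g (t - r) + η r * g (t - r))) := by
    filter_upwards [LocallyIntegrable.ae_hasDerivAt_integral hloc] with r hr
    have h1 : HasDerivAt (fun r => Real.exp (-F r)) (Real.exp (-F r) * -η r) r := (hr 0).neg.exp
    have h2 : HasDerivAt (fun r => g (t - r)) (-deriv g (t - r)) r := by
      have h3 : HasDerivAt g (deriv g (t - r)) (t - r) :=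
        (hg.differentiable one_ne_zero _).hasDerivAt
      have h4 : HasDerivAt (fun r => t - r) (-1) r := by
        simpa using (hasDerivAt_id r).const_sub t
      convert! h3.comp r h4 using 1
      ring
    rw [(h1.fun_mul h2).deriv]
    ring
  set D : ℝ → ℝ := fun r => -deriv (fun r => Real.exp (-F r) * g (t - r)) r with hD
  have hDint : IntegrableOn D (Set.Ioc 0 t) :=
    ((intervalIntegrable_iff_integrableOn_Ioc_of_le ht).1 hii).neg
  have hDθ : ∀ᵐ r ∂volume.restrict (Set.Ioc 0 t), θ r * Real.exp (-F r) ≤ D r ∧ 0 ≤ D r := by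
    rw [ae_restrict_iff' measurableSet_Ioc]
    filter_upwards [hae] with r hr hr'
    have h1 := hθ0 r hr'
    have h2 := hθ r hr'
    have h3 := Real.exp_pos (-F r)
    rw [hD]
    simp only
    rw [hr, neg_neg, mul_comm]
    exact ⟨mul_le_mul_of_nonneg_left h2 h3.le, mul_nonneg h3.le (h1.trans h2)⟩
  calc ∫⁻ r in Set.Ioc 0 t, ENNReal.ofReal (θ r * Real.exp (-F r))
      ≤ ∫⁻ r in Set.Ioc 0 t, ENNReal.ofReal (D r) :=
        lintegral_mono_ae (hDθ.mono fun r hr => ENNReal.ofReal_le_ofReal hr.1)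
    _ = ENNReal.ofReal (∫ r in Set.Ioc 0 t, D r) :=
        (ofReal_integral_eq_lintegral_ofReal hDint (hDθ.mono fun r hr => hr.2)).symm
    _ ≤ ENNReal.ofReal (g t) := by
        refine ENNReal.ofReal_le_ofReal ?_
        rw [hD, integral_neg, ← intervalIntegral.integral_of_le ht, hftc]
        have : 0 ≤ Real.exp (-F t) * g 0 := mul_nonneg (Real.exp_pos _).le hg0
        simp [hF] at this ⊢
        linarith

/-- The probability that a chain of phases, started in phase `0`, is in phase `j` at time `t`, if
phase `i` has the total exit rate `l` and is left for phase `i + 1` with rate `r i`. -/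
noncomputable def phaseProb (l : ℝ) (r : ℕ → ℝ) (j : ℕ) (t : ℝ) : ℝ :=
  Real.exp (-(l * t)) * (t ^ j / j ! * ∏ i ∈ Finset.range j, r i)

theorem contDiff_phaseProb (l : ℝ) (r : ℕ → ℝ) (j : ℕ) : ContDiff ℝ 1 (phaseProb l r j) := by
  unfold phaseProb; fun_prop

theorem phaseProb_nonneg (l : ℝ) {r : ℕ → ℝ} (hr : ∀ i, 0 ≤ r i) (j : ℕ) {t : ℝ} (ht : 0 ≤ t) :
    0 ≤ phaseProb l r j t := by
  have := Finset.prod_nonneg fun i (_ : i ∈ Finset.range j) => hr i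
  unfold phaseProb; positivity

theorem hasDerivAt_phaseProb_zero (l : ℝ) (r : ℕ → ℝ) (t : ℝ) :
    HasDerivAt (phaseProb l r 0) (-(l * phaseProb l r 0 t)) t := by
  have h1 : HasDerivAt (fun t : ℝ => l * t) l t := by
    simpa using (hasDerivAt_id t).const_mul l
  have h2 := h1.neg.exp
  convert! h2 using 1
  · funext t; simp [phaseProb]
  · simp [phaseProb]; ring

theorem hasDerivAt_phaseProb_succ (l : ℝ) (r : ℕ → ℝ) (j : ℕ) (t : ℝ) :
    HasDerivAt (phaseProb l r (j + 1)) (r j * phaseProb l r j t - l * phaseProb l r (j + 1) t) t := by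
  have h1 : HasDerivAt (fun t : ℝ => l * t) l t := by
    simpa using (hasDerivAt_id t).const_mul l
  have h2 := h1.neg.exp.mul ((((hasDerivAt_id t).pow (j + 1)).div_const ((j + 1)! : ℝ)).mul_const
    (∏ i ∈ Finset.range (j + 1), r i))
  convert! h2 using 1
  simp only [phaseProb, Nat.factorial_succ, Finset.prod_range_succ]
  have h3 : ((j ! : ℕ) : ℝ) ≠ 0 := by positivity
  have h4 : ((j : ℝ) + 1) ≠ 0 := by positivity
  push_cast
  field_simp
  simp
  ring

/-- Decomposition with respect to the time and the phase in which a chain of phases is left: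
`f j u` is the value of being in phase `j` when the time `u` remains, and `X j u` the rate of
leaving the chain there, multiplied by the value obtained. The function
`u ↦ ∑ j, phaseProb l r j u * f j (t - u)` falls from `f 0 t` to `0` on `[0, t]`; its derivative
telescopes to minus the integrand. -/
theorem eq_integral_phaseProb {l : ℝ} (t : ℝ) (r : ℕ → ℝ) {n : ℕ} {f X : ℕ → ℝ → ℝ}
    (hf : ∀ j < n, ∀ u, HasDerivAt (f j) (X j u + r j * f (j + 1) u - l * f j u) u)
    (hn : ∀ u, f n u = 0) (h0 : ∀ j, f j 0 = 0) (hX : ∀ j, Continuous (X j)) :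
    f 0 t = ∫ u in (0 : ℝ)..t, ∑ j ∈ Finset.range n, phaseProb l r j u * X j (t - u) := by
  rcases Nat.eq_zero_or_pos n with rfl | hpos
  · simp [hn]
  set Φ : ℝ → ℝ := fun u => ∑ j ∈ Finset.range n, phaseProb l r j u * f j (t - u) with hΦ
  let a : ℝ → ℕ → ℝ := fun u j => match j with
    | 0 => 0
    | j + 1 => r j * phaseProb l r j u * f (j + 1) (t - u)
  have hpp : ∀ j u, HasDerivAt (phaseProb l r j)
      ((match j with | 0 => 0 | j + 1 => r j * phaseProb l r j u) - l * phaseProb l r j u) u := by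
    intro j u
    cases j with
    | zero => simpa using hasDerivAt_phaseProb_zero l r u
    | succ j => exact hasDerivAt_phaseProb_succ l r j u
  have hder : ∀ u, HasDerivAt Φ
      (-∑ j ∈ Finset.range n, phaseProb l r j u * X j (t - u)) u := by
    intro u
    have h1 : ∀ j ∈ Finset.range n, HasDerivAt (fun u => phaseProb l r j u * f j (t - u))
        (a u j - a u (j + 1) - phaseProb l r j u * X j (t - u)) u := by
      intro j hj
      have h4 : HasDerivAt (fun r => t - r) (-1) u := by
        simpa using (hasDerivAt_id u).const_sub t
      have h5 := (hpp j u).mul ((hf j (Finset.mem_range.1 hj) (t - u)).comp u h4)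
      convert! h5 using 1
      cases j <;> simp only [a, Function.comp] <;> ring
    have h2 := HasDerivAt.fun_sum h1
    convert! h2 using 1
    rw [Finset.sum_sub_distrib, Finset.sum_range_sub' (a u)]
    obtain ⟨k, rfl⟩ : ∃ k, n = k + 1 := ⟨n - 1, by omega⟩
    simp [a, hn]
  have hcont : Continuous fun u => -∑ j ∈ Finset.range n, phaseProb l r j u * X j (t - u) := by
    refine (continuous_finsetSum _ fun j _ => ?_).neg
    exact (contDiff_phaseProb l r j).continuous.mul ((hX j).comp (by fun_prop))
  have hftc := intervalIntegral.integral_eq_sub_of_hasDerivAt (fun u _ => hder u)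
    (hcont.intervalIntegrable 0 t)
  rw [intervalIntegral.integral_neg] at hftc
  have e1 : Φ t = 0 := by simp [hΦ, h0]
  have e2 : Φ 0 = f 0 t := by
    simp only [hΦ]
    rw [Finset.sum_eq_single 0]
    · simp [phaseProb]
    · intro j _ hj
      simp [phaseProb, hj]
    · simp; omega
  linarith

end Hazard

/-! ### The recursions of the algorithm -/

section Recursion

variable {U Act : Type*} [Fintype U]

theorem prob_nonneg (D : CTMDP U Act) (u : U) (a : Act) (v : U) : 0 ≤ D.prob u a v :=
  div_nonneg (D.rate_nonneg u a v) (D.exit_nonneg u a)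

/-- The sum is `1` or, if the exit rate is zero, `0`. -/
theorem sum_prob_le_one (D : CTMDP U Act) (u : U) (a : Act) : ∑ v, D.prob u a v ≤ 1 := by
  simp only [prob]
  rw [← Finset.sum_div]
  exact div_self_le_one _

theorem exit_mul_prob (D : CTMDP U Act) (u : U) (a : Act) (v : U) :
    D.exit u a * D.prob u a v = D.rate u a v := by
  rcases eq_or_ne (D.exit u a) 0 with h | h
  · have : D.rate u a v = 0 :=
      (Finset.sum_eq_zero_iff_of_nonneg fun v _ => D.rate_nonneg u a v).1 h v (mem_univ v)
    rw [h, this, zero_mul]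
  · rw [prob, mul_div_cancel₀ _ h]

theorem sum_prob_mono (D : CTMDP U Act) (u : U) (a : Act) {f g : U → ℝ} (h : ∀ v, f v ≤ g v) :
    ∑ v, D.prob u a v * f v ≤ ∑ v, D.prob u a v * g v :=
  Finset.sum_le_sum fun v _ => mul_le_mul_of_nonneg_left (h v) (D.prob_nonneg u a v)

theorem sum_prob_le (D : CTMDP U Act) (u : U) (a : Act) {f : U → ℝ} {c : ℝ} (hc : 0 ≤ c)
    (h : ∀ v, f v ≤ c) : ∑ v, D.prob u a v * f v ≤ c := by
  refine (D.sum_prob_mono u a h).trans ?_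
  rw [← Finset.sum_mul]
  exact mul_le_of_le_one_left hc (D.sum_prob_le_one u a)

theorem le_bellman (D : CTMDP U Act) (f : U → ℝ) {u : U} {a : Act} (ha : a ∈ D.enabled u) :
    ∑ v, D.prob u a v * f v ≤ D.bellman f u :=
  Finset.le_sup' (fun a => ∑ v, D.prob u a v * f v) ha

theorem bellman_le (D : CTMDP U Act) (f : U → ℝ) {u : U} {c : ℝ}
    (h : ∀ a ∈ D.enabled u, ∑ v, D.prob u a v * f v ≤ c) : D.bellman f u ≤ c :=
  Finset.sup'_le _ _ h

theorem exists_bellman_eq (D : CTMDP U Act) (f : U → ℝ) (u : U) :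
    ∃ a ∈ D.enabled u, D.bellman f u = ∑ v, D.prob u a v * f v :=
  Finset.exists_mem_eq_sup' (D.enabled_nonempty u) fun a => ∑ v, D.prob u a v * f v

variable (D : CTMDP U Act) (G : Set U)

theorem bellman_nonneg {f : U → ℝ} (hf : ∀ v, 0 ≤ f v) (u : U) : 0 ≤ D.bellman f u := by
  obtain ⟨a, _, h⟩ := D.exists_bellman_eq f u
  rw [h]
  exact Finset.sum_nonneg fun v _ => mul_nonneg (D.prob_nonneg u a v) (hf v)

theorem reachRem_succ_of_mem {u : U} (hu : u ∈ G) (r : ℕ) : D.reachRem G (r + 1) u = 1 := by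
  simp [reachRem, hu]

theorem reachRem_succ_of_notMem {u : U} (hu : u ∉ G) (r : ℕ) :
    D.reachRem G (r + 1) u = D.bellman (D.reachRem G r) u := by
  simp [reachRem, hu]

theorem reachRem_nonneg (r : ℕ) (u : U) : 0 ≤ D.reachRem G r u := by
  induction r generalizing u with
  | zero => exact le_rfl
  | succ r ih =>
    by_cases hu : u ∈ G
    · rw [D.reachRem_succ_of_mem G hu]; exact zero_le_one
    · rw [D.reachRem_succ_of_notMem G hu]; exact D.bellman_nonneg ih u

theorem reachRem_le_one (r : ℕ) (u : U) : D.reachRem G r u ≤ 1 := by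
  induction r generalizing u with
  | zero => exact zero_le_one
  | succ r ih =>
    by_cases hu : u ∈ G
    · rw [D.reachRem_succ_of_mem G hu]
    · rw [D.reachRem_succ_of_notMem G hu]
      exact D.bellman_le _ fun a _ => D.sum_prob_le u a zero_le_one ih

theorem sum_prob_reachRem_le {u : U} (hu : u ∉ G) {a : Act} (ha : a ∈ D.enabled u) (r : ℕ) :
    ∑ v, D.prob u a v * D.reachRem G r v ≤ D.reachRem G (r + 1) u := by
  rw [D.reachRem_succ_of_notMem G hu]
  exact D.le_bellman _ ha

open Classical in
/-- One more step helps at most as much as the probability of entering the goal in one step. -/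
theorem reachRem_succ_le_add {δ : ℝ} (hδ : 0 ≤ δ)
    (hG : ∀ u ∉ G, ∀ a ∈ D.enabled u, ∑ v ∈ univ.filter (· ∈ G), D.prob u a v ≤ δ) (r : ℕ) (u : U) :
    D.reachRem G (r + 2) u ≤ D.reachRem G (r + 1) u + δ := by
  induction r generalizing u with
  | zero =>
    by_cases hu : u ∈ G
    · rw [D.reachRem_succ_of_mem G hu, D.reachRem_succ_of_mem G hu]; linarith
    · have h1 := D.reachRem_nonneg G 1 u
      suffices D.reachRem G 2 u ≤ δ by simp only [Nat.zero_add]; linarith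
      rw [D.reachRem_succ_of_notMem G hu]
      refine D.bellman_le _ fun a ha => le_trans (le_of_eq ?_) (hG u hu a ha)
      rw [Finset.sum_filter]
      refine Finset.sum_congr rfl fun v _ => ?_
      split_ifs with hv
      · rw [D.reachRem_succ_of_mem G hv, mul_one]
      · obtain ⟨b, _, hb⟩ := D.exists_bellman_eq (D.reachRem G 0) v
        rw [D.reachRem_succ_of_notMem G hv, hb]
        simp [reachRem]
  | succ r ih =>
    by_cases hu : u ∈ G
    · rw [D.reachRem_succ_of_mem G hu, D.reachRem_succ_of_mem G hu]; linarith
    · rw [D.reachRem_succ_of_notMem G hu]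
      refine D.bellman_le _ fun a ha => ?_
      have h1 := D.sum_prob_reachRem_le G hu ha (r + 1)
      have h2 := D.sum_prob_mono u a ih
      simp only [mul_add, Finset.sum_add_distrib, ← Finset.sum_mul] at h2
      have h3 := mul_le_of_le_one_left hδ (D.sum_prob_le_one u a)
      exact h2.trans (add_le_add h1 h3)

theorem reachRem_add_le {δ : ℝ} (h : ∀ r u, D.reachRem G (r + 2) u ≤ D.reachRem G (r + 1) u + δ)
    (n k : ℕ) (u : U) : D.reachRem G (n + k + 1) u ≤ D.reachRem G (n + 1) u + k * δ := by
  induction k with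
  | zero => simp
  | succ k ih =>
    have := h (n + k) u
    push_cast
    have e : n + (k + 1) + 1 = n + k + 2 := by ring
    rw [e]
    linarith

variable {w : ℕ → ℝ}

theorem lowerRem_nonneg (hw : ∀ i, 0 ≤ w i) (N r : ℕ) (u : U) : 0 ≤ D.lowerRem G w N r u := by
  induction r generalizing u with
  | zero => exact le_rfl
  | succ r ih =>
    by_cases hu : u ∈ G
    · simp only [lowerRem, hu, if_true]
      exact Finset.sum_nonneg fun i _ => hw i
    · simp only [lowerRem, hu, if_false]
      exact D.bellman_nonneg ih u

theorem lowerRem_le (hw : ∀ i, 0 ≤ w i) (N r : ℕ) (hr : r ≤ N) (u : U) :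
    D.lowerRem G w N r u ≤ ∑ i ∈ Finset.range r, w (N - r + i) * D.reachRem G (i + 1) u := by
  induction r generalizing u with
  | zero => simp [lowerRem]
  | succ r ih =>
    by_cases hu : u ∈ G
    · simp only [lowerRem, hu, if_true]
      rw [Finset.sum_Ico_eq_sum_range]
      have : N - (N - (r + 1)) = r + 1 := by omega
      rw [this]
      refine Finset.sum_le_sum fun i _ => ?_
      rw [D.reachRem_succ_of_mem G hu, mul_one]
    · simp only [lowerRem, hu, if_false]
      refine D.bellman_le _ fun a ha => ?_
      refine (D.sum_prob_mono u a (ih (by omega))).trans ?_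
      rw [Finset.sum_range_succ']
      refine le_trans ?_ (le_add_of_nonneg_right (mul_nonneg (hw _) (D.reachRem_nonneg G _ u)))
      simp only [Finset.mul_sum]
      rw [Finset.sum_comm]
      refine Finset.sum_le_sum fun i _ => ?_
      have e : N - (r + 1) + (i + 1) = N - r + i := by omega
      rw [e]
      simp only [mul_left_comm _ (w _)]
      rw [← Finset.mul_sum]
      exact mul_le_mul_of_nonneg_left (D.sum_prob_reachRem_le G hu ha _) (hw _)

/-- The lower bound is at least what the optimal scheduler for the step bound `n` achieves if the
number of steps is at least `n`. -/
theorem le_lowerRem (hw : ∀ i, 0 ≤ w i) {n N : ℕ} (hn : n < N) (r : ℕ) (hr : r ≤ N) (u : U) :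
    (∑ i ∈ Finset.Ico n N, w i) * D.reachRem G (n + 1 - (N - r)) u ≤ D.lowerRem G w N r u := by
  have hW : 0 ≤ ∑ i ∈ Finset.Ico n N, w i := Finset.sum_nonneg fun i _ => hw i
  induction r generalizing u with
  | zero =>
    have : n + 1 - (N - 0) = 0 := by omega
    rw [this]
    simp [lowerRem, reachRem]
  | succ r ih =>
    rcases Nat.eq_zero_or_pos (n + 1 - (N - (r + 1))) with h0 | hpos
    · rw [h0]
      simpa [reachRem] using D.lowerRem_nonneg G hw N (r + 1) u
    · have e : n + 1 - (N - (r + 1)) = (n + 1 - (N - r)) + 1 := by omega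
      rw [e]
      by_cases hu : u ∈ G
      · rw [D.reachRem_succ_of_mem G hu, mul_one]
        simp only [lowerRem, hu, if_true]
        exact Finset.sum_le_sum_of_subset_of_nonneg
          (Finset.Ico_subset_Ico_left (by omega)) fun i _ _ => hw i
      · rw [D.reachRem_succ_of_notMem G hu]
        simp only [lowerRem, hu, if_false]
        obtain ⟨a, ha, h⟩ := D.exists_bellman_eq (D.reachRem G (n + 1 - (N - r))) u
        rw [h, Finset.mul_sum]
        refine le_trans (le_of_eq ?_) ((D.sum_prob_mono u a (ih (by omega))).trans
          (D.le_bellman _ ha))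
        exact Finset.sum_congr rfl fun v _ => by ring

theorem upperVal_zero (N : ℕ) (u : U) :
    D.upperVal G w N 0 u = ∑ i ∈ Finset.range N, w i * D.reachRem G (i + 1) u := by
  rw [upperVal, Nat.Ico_zero_eq_range]
  refine Finset.sum_congr rfl fun i hi => ?_
  have := Finset.mem_range.1 hi
  congr 2
  omega

theorem lowerVal_zero_le_upperVal_zero (hw : ∀ i, 0 ≤ w i) (N : ℕ) (u : U) :
    D.lowerVal G w N 0 u ≤ D.upperVal G w N 0 u := by
  rw [upperVal_zero]
  simpa [lowerVal] using D.lowerRem_le G hw N N le_rfl u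

theorem upperVal_sub_lowerVal_le (hw : ∀ i, 0 ≤ w i) {δ : ℝ}
    (h : ∀ r u, D.reachRem G (r + 2) u ≤ D.reachRem G (r + 1) u + δ) (n N : ℕ) (u : U) :
    D.upperVal G w N 0 u - D.lowerVal G w N 0 u ≤
      ∑ i ∈ Finset.range N, w i * (if i < n then 1 else ((i : ℝ) - n) * δ) := by
  have hmain : (∑ i ∈ Finset.range N, w i * if i < n then 0 else D.reachRem G (n + 1) u) ≤
      D.lowerVal G w N 0 u := by
    rcases lt_or_ge n N with hn | hn
    · have h1 := D.le_lowerRem G hw hn N le_rfl u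
      rw [Nat.sub_self, Nat.sub_zero] at h1
      rw [lowerVal, Nat.sub_zero]
      refine le_trans (le_of_eq ?_) h1
      rw [← Finset.sum_range_add_sum_Ico _ hn.le, Finset.sum_mul]
      rw [Finset.sum_eq_zero fun i hi => by simp [Finset.mem_range.1 hi], zero_add]
      refine Finset.sum_congr rfl fun i hi => ?_
      rw [if_neg (not_lt.2 (Finset.mem_Ico.1 hi).1)]
    · refine le_trans (le_of_eq ?_) (D.lowerRem_nonneg G hw N _ u)
      refine Finset.sum_eq_zero fun i hi => ?_
      rw [if_pos ((Finset.mem_range.1 hi).trans_le hn), mul_zero]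
  rw [upperVal_zero]
  refine (sub_le_sub_left hmain _).trans ?_
  rw [← Finset.sum_sub_distrib]
  refine Finset.sum_le_sum fun i _ => ?_
  rw [← mul_sub]
  refine mul_le_mul_of_nonneg_left ?_ (hw i)
  split_ifs with hi
  · simpa using D.reachRem_le_one G (i + 1) u
  · obtain ⟨k, rfl⟩ := Nat.exists_eq_add_of_le (not_lt.1 hi)
    have := D.reachRem_add_le G h n k u
    push_cast
    linarith

theorem gap_le (hw : ∀ i, 0 ≤ w i) {δ : ℝ} (hδ : 0 ≤ δ)
    (h : ∀ r u, D.reachRem G (r + 2) u ≤ D.reachRem G (r + 1) u + δ) (n N : ℕ) :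
    D.gap G w N ≤ ∑ i ∈ Finset.range N, w i * (if i < n then 1 else ((i : ℝ) - n) * δ) := by
  rw [gap, pi_norm_le_iff_of_nonneg]
  · intro u
    rw [Pi.sub_apply, Real.norm_of_nonneg (sub_nonneg.2 (D.lowerVal_zero_le_upperVal_zero G hw N u))]
    exact D.upperVal_sub_lowerVal_le G hw h n N u
  · refine Finset.sum_nonneg fun i _ => mul_nonneg (hw i) ?_
    split_ifs with hi
    · exact zero_le_one
    · have : (n : ℝ) ≤ i := by exact_mod_cast not_lt.1 hi
      exact mul_nonneg (by linarith) hδ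

theorem lowerVal_of_notMem {N k : ℕ} (hk : k < N) {u : U} (hu : u ∉ G) :
    D.lowerVal G w N k u = D.bellman (D.lowerVal G w N (k + 1)) u := by
  have e : N - k = (N - (k + 1)) + 1 := by omega
  simp only [lowerVal, e, lowerRem, hu, if_false]

theorem exists_isMaximiser (N k : ℕ) (u : U) : ∃ a, D.IsMaximiser G w N k u a := by
  obtain ⟨a, ha, h⟩ := D.exists_bellman_eq (D.lowerVal G w N (k + 1)) u
  exact ⟨a, ha, fun hk hu => by rw [D.lowerVal_of_notMem G hk hu, h]⟩

end Recursion

/-! ### Uniformisation -/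

section Uniformisation

variable {S Act : Type*} [Fintype S] [Fintype Act] (C : CTMDP S Act) {l : ℝ} (hl : C.maxExit ≤ l)

theorem lateUnif_sum_rate {s : S} {a : Act} (ha : a ∈ C.enabled s) (f : S → ℝ) :
    ∑ s', (C.lateUnif l hl).rate s a s' * f s' =
      ∑ s', C.rate s a s' * f s' + (l - C.exit s a) * f s := by
  classical
  rw [← Finset.add_sum_erase _ _ (mem_univ s), ← Finset.add_sum_erase _ _ (mem_univ s)]
  have h1 : ∑ s' ∈ univ.erase s, (C.lateUnif l hl).rate s a s' * f s' =
      ∑ s' ∈ univ.erase s, C.rate s a s' * f s' := by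
    refine Finset.sum_congr rfl fun s' hs' => ?_
    have : s ≠ s' := (Finset.ne_of_mem_erase hs').symm
    simp [lateUnif, ha, this]
  have h2 : (C.lateUnif l hl).rate s a s = l - C.exit s a + C.rate s a s := by
    have : C.exit s a = C.rate s a s + ∑ s' ∈ univ.erase s, C.rate s a s' :=
      (Finset.add_sum_erase _ _ (mem_univ s)).symm
    rw [this]
    simp only [lateUnif, ha, if_true]
    ring
  rw [h1, h2]
  ring

theorem earlyUnif_sum_rate {u : S × Option Act} {a : Act}
    (ha : a ∈ (C.earlyUnif l hl).enabled u) (f : S × Option Act → ℝ) :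
    ∑ v, (C.earlyUnif l hl).rate u a v * f v =
      ∑ s', C.rate u.1 a s' * f (s', none) + (l - C.exit u.1 a) * f (u.1, some a) := by
  classical
  have ha' : a ∈ u.2.elim (C.enabled u.1) (fun b => {b}) := ha
  rw [Fintype.sum_prod_type]
  have h1 : ∀ s', ∑ b, (C.earlyUnif l hl).rate u a (s', b) * f (s', b) =
      C.rate u.1 a s' * f (s', none) +
        if u.1 = s' then (l - C.exit u.1 a) * f (u.1, some a) else 0 := by
    intro s'
    rw [Fintype.sum_option]
    congr 1
    · simp [earlyUnif, ha']
    · rw [Finset.sum_eq_single a]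
      · by_cases h : u.1 = s'
        · subst h
          simp [earlyUnif, ha']
        · simp [earlyUnif, ha', h]
      · intro b _ hb
        simp [earlyUnif, hb]
      · simp
  simp only [h1, Finset.sum_add_distrib]
  simp

theorem lateUnif_exit {s : S} {a : Act} (ha : a ∈ C.enabled s) : (C.lateUnif l hl).exit s a = l := by
  have := C.lateUnif_sum_rate hl ha fun _ => 1
  simp only [mul_one] at this
  rw [exit, this, exit]
  ring

theorem earlyUnif_exit {u : S × Option Act} {a : Act} (ha : a ∈ (C.earlyUnif l hl).enabled u) :
    (C.earlyUnif l hl).exit u a = l := by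
  have := C.earlyUnif_sum_rate hl ha fun _ => 1
  simp only [mul_one] at this
  rw [exit, this, exit]
  ring

open Classical in
theorem lateUnif_sum_prob_goal_le {G : Set S} {s : S} (hs : s ∉ G) {a : Act}
    (ha : a ∈ C.enabled s) :
    ∑ v ∈ univ.filter (· ∈ G), (C.lateUnif l hl).prob s a v ≤ C.maxExit / l := by
  have hl0 : 0 ≤ l := C.maxExit_nonneg.trans hl
  simp only [prob, C.lateUnif_exit hl ha]
  rw [← Finset.sum_div]
  refine div_le_div_of_nonneg_right ?_ hl0
  refine le_trans (le_of_eq ?_) ((C.sum_le_exit s a (univ.filter (· ∈ G))).trans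
    (C.exit_le_maxExit s a))
  refine Finset.sum_congr rfl fun v hv => ?_
  have : s ≠ v := fun h => hs (h ▸ (Finset.mem_filter.1 hv).2)
  simp [lateUnif, ha, this]

open Classical in
theorem earlyUnif_sum_prob_goal_le {G : Set S} {u : S × Option Act} (hu : u ∉ earlyGoal Act G)
    {a : Act} (ha : a ∈ (C.earlyUnif l hl).enabled u) :
    ∑ v ∈ univ.filter (· ∈ earlyGoal Act G), (C.earlyUnif l hl).prob u a v ≤ C.maxExit / l := by
  have hl0 : 0 ≤ l := C.maxExit_nonneg.trans hl
  simp only [prob, C.earlyUnif_exit hl ha]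
  rw [← Finset.sum_div]
  refine div_le_div_of_nonneg_right ?_ hl0
  have hug : u.1 ∉ G := hu
  rw [Finset.sum_filter]
  have h1 : ∀ v, (if v ∈ earlyGoal Act G then (C.earlyUnif l hl).rate u a v else 0) =
      (C.earlyUnif l hl).rate u a v * if v ∈ earlyGoal Act G then 1 else 0 := fun v => by
    split_ifs <;> simp
  simp only [h1]
  rw [C.earlyUnif_sum_rate hl ha]
  have h2 : (u.1, some a) ∉ earlyGoal Act G := hug
  rw [if_neg h2, mul_zero, add_zero]
  refine le_trans ?_ (C.exit_le_maxExit u.1 a)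
  exact Finset.sum_le_sum fun s' _ => mul_le_of_le_one_right (C.rate_nonneg _ _ _)
    (by split_ifs <;> norm_num)

end Uniformisation

/-! ### Termination -/

section Termination

/-- Poisson averages of the bound for the gap: Chebyshev's inequality for the points below
`r - c`, and a linear bound for the others. -/
theorem sum_pois_gap_le {r c δ : ℝ} (hc : 0 < c) (hcr : c ≤ r) (hδ : 0 ≤ δ) (N : ℕ) :
    ∑ i ∈ Finset.range N, pois r i *
        (if i < ⌊r - c⌋₊ then 1 else ((i : ℝ) - ⌊r - c⌋₊) * δ) ≤
      r / c ^ 2 + δ * (r / c + 2 * c + 1) := by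
  have hr : 0 ≤ r := hc.le.trans hcr
  set n := ⌊r - c⌋₊ with hn
  have hn1 : (n : ℝ) ≤ r - c := Nat.floor_le (by linarith)
  have hn2 : r - c < n + 1 := Nat.lt_floor_add_one _
  have hpt : ∀ i : ℕ, (if i < n then 1 else ((i : ℝ) - n) * δ) ≤
      ((i : ℝ) - r) ^ 2 * (1 / c ^ 2 + δ / c) + δ * (2 * c + 1) := by
    intro i
    have hsq := sq_nonneg ((i : ℝ) - r)
    split_ifs with hi
    · have hi' : (i : ℝ) < n := by exact_mod_cast hi
      have h1 : 1 ≤ ((i : ℝ) - r) ^ 2 * (1 / c ^ 2) := by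
        rw [mul_one_div, le_div_iff₀ (by positivity)]
        nlinarith
      have h2 : 0 ≤ ((i : ℝ) - r) ^ 2 * (δ / c) := by positivity
      have h3 : 0 ≤ δ * (2 * c + 1) := by positivity
      linarith
    · have h1 : (i : ℝ) - n ≤ ((i : ℝ) - r) ^ 2 / c + (2 * c + 1) := by
        have h2 : (i : ℝ) - r ≤ ((i : ℝ) - r) ^ 2 / c + c := by
          rw [← sub_le_iff_le_add, le_div_iff₀ hc]
          nlinarith [sq_nonneg ((i : ℝ) - r - c / 2)]
        linarith
      have h3 : 0 ≤ ((i : ℝ) - r) ^ 2 * (1 / c ^ 2) := by positivity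
      have h4 := mul_le_mul_of_nonneg_right h1 hδ
      have h5 : (((i : ℝ) - r) ^ 2 / c + (2 * c + 1)) * δ =
          ((i : ℝ) - r) ^ 2 * (δ / c) + δ * (2 * c + 1) := by ring
      linarith
  have hs := ((hasSum_pois_variance r).mul_right (1 / c ^ 2 + δ / c)).add
    ((hasSum_pois r).mul_right (δ * (2 * c + 1)))
  have hle : ∀ i, pois r i * (if i < n then 1 else ((i : ℝ) - n) * δ) ≤
      pois r i * ((i : ℝ) - r) ^ 2 * (1 / c ^ 2 + δ / c) + pois r i * (δ * (2 * c + 1)) := by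
    intro i
    have := mul_le_mul_of_nonneg_left (hpt i) (pois_nonneg hr i)
    linarith
  refine (Finset.sum_le_sum fun i _ => hle i).trans ((sum_le_hasSum _ (fun i _ => ?_) hs).trans
    (le_of_eq ?_))
  · have := pois_nonneg hr i
    positivity
  · field_simp
    ring

variable {S Act : Type*} [Fintype S] [Fintype Act] (C : CTMDP S Act)

/-- The termination test is passed if the bound for the gap is small, for some `n`. -/
theorem stops_of_le (x : Timing) (G : Set S) {T ε κ : ℝ} (hT : 0 ≤ T) (j n : ℕ)
    (h : ∑ i ∈ Finset.range (truncation (C.rateAt j) T ε κ), pois (C.rateAt j * T) i *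
        (if i < n then 1 else ((i : ℝ) - n) * (C.maxExit / C.rateAt j)) ≤ ε * (1 - κ)) :
    C.Stops x G T ε κ j := by
  classical
  have hl0 : 0 ≤ C.rateAt j := C.maxExit_nonneg.trans (C.maxExit_le_rateAt j)
  have hδ : 0 ≤ C.maxExit / C.rateAt j := div_nonneg C.maxExit_nonneg hl0
  have hw := pois_nonneg (mul_nonneg hl0 hT)
  cases x with
  | late =>
    refine le_trans (gap_le _ G hw hδ (reachRem_succ_le_add _ G hδ ?_) n _) h
    exact fun u hu a ha => C.lateUnif_sum_prob_goal_le _ hu ha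
  | early =>
    refine le_trans (gap_le _ (earlyGoal Act G) hw hδ (reachRem_succ_le_add _ _ hδ ?_) n _) h
    exact fun u hu a ha => C.earlyUnif_sum_prob_goal_le _ hu ha

theorem exists_stops (x : Timing) (G : Set S) {T ε κ : ℝ} (hT : 0 ≤ T) (hε : 0 < ε)
    (hκ : κ < 1) : ∃ j, C.Stops x G T ε κ j := by
  have hθ : 0 < ε * (1 - κ) := mul_pos hε (by linarith)
  set A := C.maxExit * T with hA
  have hA0 : 0 ≤ A := mul_nonneg C.maxExit_nonneg hT
  have hrj : ∀ j, C.rateAt j * T = 2 ^ j * A := fun j => by rw [rateAt, hA]; ring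
  rcases hA0.eq_or_lt with h0 | hpos
  · -- only the Poisson weight of the point `0` is nonzero
    refine ⟨0, C.stops_of_le x G hT 0 0 (le_trans (le_of_eq ?_) hθ.le)⟩
    refine Finset.sum_eq_zero fun i _ => ?_
    rw [hrj, ← h0]
    rcases Nat.eq_zero_or_pos i with rfl | hi
    · simp
    · simp [pois, hi.ne']
  · set θ := ε * (1 - κ) with hθd
    -- the deviation `c = η r` from the mean `r = 2 ^ j A` contributes `2 η A` in the limit
    obtain ⟨η, hη0, hη1, hη2⟩ : ∃ η : ℝ, 0 < η ∧ η ≤ 1 ∧ 2 * η * A ≤ θ / 2 := by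
      refine ⟨min 1 (θ / (4 * A)), by positivity, min_le_left _ _, ?_⟩
      have h1 : min 1 (θ / (4 * A)) ≤ θ / (4 * A) := min_le_right _ _
      rw [le_div_iff₀ (by positivity)] at h1
      linarith
    set B := 1 / (η ^ 2 * A) + 1 / η + 1 with hB
    have hB0 : 0 < B := by positivity
    obtain ⟨j, hj⟩ := exists_pow_lt_of_lt_one (show 0 < θ / 2 / B by positivity)
      (show (1 / 2 : ℝ) < 1 by norm_num)
    rw [lt_div_iff₀ hB0] at hj
    have hmax : C.maxExit ≠ 0 := fun h => by simp [hA, h] at hpos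
    refine ⟨j, C.stops_of_le x G hT j ⌊2 ^ j * A - η * (2 ^ j * A)⌋₊ ?_⟩
    have hδ : C.maxExit / C.rateAt j = (1 / 2) ^ j := by
      rw [rateAt, one_div, inv_pow]
      field_simp
    rw [hrj, hδ]
    have hp : 0 < (2 : ℝ) ^ j * A := by positivity
    refine (sum_pois_gap_le (mul_pos hη0 hp) (mul_le_of_le_one_left hp.le hη1)
      (by positivity) _).trans ?_
    have e : 2 ^ j * A / (η * (2 ^ j * A)) ^ 2 + (1 / 2) ^ j *
        (2 ^ j * A / (η * (2 ^ j * A)) + 2 * (η * (2 ^ j * A)) + 1) =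
        (1 / 2) ^ j * B + 2 * η * A := by
      rw [hB, one_div, inv_pow]
      field_simp
      ring
    rw [e]
    linarith

theorem exists_terminates (x : Timing) (G : Set S) {T ε κ : ℝ} (hT : 0 ≤ T) (hε : 0 < ε)
    (hκ : κ < 1) : ∃ j, C.Terminates x G T ε κ j := by
  classical
  have h := C.exists_stops x G hT hε hκ
  exact ⟨Nat.find h, Nat.find_spec h, fun i hi => Nat.find_min h hi⟩

theorem exists_isGreedy (x : Timing) (G : Set S) (T ε κ : ℝ) (j : ℕ) :
    ∃ d : ℕ → (s : S) → C.enabled s, C.IsGreedy x G T ε κ j d := by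
  cases x with
  | late =>
    choose a ha using fun k s =>
      (C.lateUnif (C.rateAt j) (C.maxExit_le_rateAt j)).exists_isMaximiser G
        (w := pois (C.rateAt j * T)) (truncation (C.rateAt j) T ε κ) k s
    exact ⟨fun k s => ⟨a k s, (ha k s).1⟩, fun k s => ha k s⟩
  | early =>
    choose a ha using fun k s =>
      (C.earlyUnif (C.rateAt j) (C.maxExit_le_rateAt j)).exists_isMaximiser (earlyGoal Act G)
        (w := pois (C.rateAt j * T)) (truncation (C.rateAt j) T ε κ) k (s, none)
    exact ⟨fun k s => ⟨a k s, (ha k s).1⟩, fun k s => ha k s⟩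

end Termination

/-! ### The upper bound for the value -/

section Upper

section Potential

variable {U Act : Type*} [Fintype U] (D : CTMDP U Act) (G : Set U)

/-- The upper bound as a function of the remaining time `t`. If `i` steps are made in this time, the
goal is missed with probability at least `1 - reachRem (i + 1)`. Only the step numbers `i < N` are
taken into account, and the goal counts as reached for the others: with this choice the finite sum
is equal to `1` on the goal, and `sum_rate_upperFn_le` holds without an error term. -/
noncomputable def upperFn (l : ℝ) (N : ℕ) (u : U) (t : ℝ) : ℝ :=
  1 - poisSum l (fun i => 1 - D.reachRem G (i + 1) u) N t

theorem contDiff_upperFn (l : ℝ) (N : ℕ) (u : U) : ContDiff ℝ 1 (D.upperFn G l N u) :=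
  contDiff_const.sub (contDiff_poisSum l _ N)

theorem upperFn_nonneg {l t : ℝ} (h : 0 ≤ l * t) (N : ℕ) (u : U) : 0 ≤ D.upperFn G l N u t :=
  sub_nonneg.2 (poisSum_le_one h (fun _ => sub_le_self _ (D.reachRem_nonneg G _ u)) N)

theorem upperFn_of_mem {u : U} (hu : u ∈ G) (l : ℝ) (N : ℕ) (t : ℝ) : D.upperFn G l N u t = 1 := by
  simp [upperFn, poisSum, D.reachRem_succ_of_mem G hu]

theorem upperFn_eq_upperVal (l T : ℝ) (N : ℕ) (u : U) :
    D.upperFn G l N u T =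
      D.upperVal G (pois (l * T)) N 0 u + (1 - ∑ i ∈ Finset.range N, pois (l * T) i) := by
  rw [upperFn, upperVal_zero, poisSum]
  simp only [mul_sub, mul_one, Finset.sum_sub_distrib]
  ring

/-- The Hamilton–Jacobi–Bellman inequality for the upper bound. -/
theorem sum_rate_upperFn_le {l t : ℝ} (h : 0 ≤ l * t) (hl : 0 ≤ l) (N : ℕ) {u : U} (hu : u ∉ G)
    {a : Act} (ha : a ∈ D.enabled u) (hexit : D.exit u a = l) :
    ∑ v, D.rate u a v * D.upperFn G l N v t ≤
      deriv (D.upperFn G l N u) t + l * D.upperFn G l N u t := by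
  have hrate : ∑ v, D.rate u a v = l := hexit
  rcases N with _ | n
  · have : D.upperFn G l 0 = fun _ _ => 1 := by
      funext u t; simp [upperFn, poisSum]
    simp [this, hrate]
  · have hder : deriv (D.upperFn G l (n + 1) u) t =
        -(l * (poisSum l (fun i => 1 - D.reachRem G (i + 1 + 1) u) n t -
          poisSum l (fun i => 1 - D.reachRem G (i + 1) u) (n + 1) t)) :=
      ((hasDerivAt_poisSum l _ n t).const_sub 1).deriv
    have h1 : ∑ v, D.rate u a v * D.upperFn G l (n + 1) v t =
        l - ∑ i ∈ Finset.range (n + 1), pois (l * t) i *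
          ∑ v, D.rate u a v * (1 - D.reachRem G (i + 1) v) := by
      simp only [upperFn, poisSum, mul_sub (D.rate u a _) 1 (Finset.sum _ _), mul_one,
        Finset.sum_sub_distrib, hrate, Finset.mul_sum]
      rw [Finset.sum_comm]
      congr 1
      exact Finset.sum_congr rfl fun i _ => Finset.sum_congr rfl fun v _ => by ring
    have h2 : ∀ i, l * (1 - D.reachRem G (i + 1 + 1) u) ≤
        ∑ v, D.rate u a v * (1 - D.reachRem G (i + 1) v) := by
      intro i
      have h3 : ∑ v, D.rate u a v * D.reachRem G (i + 1) v =
          l * ∑ v, D.prob u a v * D.reachRem G (i + 1) v := by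
        rw [Finset.mul_sum]
        exact Finset.sum_congr rfl fun v _ => by rw [← D.exit_mul_prob, hexit, mul_assoc]
      simp only [mul_sub, mul_one, Finset.sum_sub_distrib, hrate, h3]
      have := mul_le_mul_of_nonneg_left (D.sum_prob_reachRem_le G hu ha (i + 1)) hl
      linarith
    have h4 : l * poisSum l (fun i => 1 - D.reachRem G (i + 1 + 1) u) (n + 1) t ≤
        ∑ i ∈ Finset.range (n + 1), pois (l * t) i *
          ∑ v, D.rate u a v * (1 - D.reachRem G (i + 1) v) := by
      rw [poisSum, Finset.mul_sum]
      refine Finset.sum_le_sum fun i _ => ?_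
      have := mul_le_mul_of_nonneg_left (h2 i) (pois_nonneg h i)
      linarith
    have h5 := mul_le_mul_of_nonneg_left (poisSum_mono h
      (c := fun i => 1 - D.reachRem G (i + 1 + 1) u)
      (fun i => sub_nonneg.2 (D.reachRem_le_one G _ u)) (Nat.le_succ n)) hl
    rw [h1, hder]
    simp only [upperFn]
    linarith

theorem upperFn_zero_nonneg (l : ℝ) (N : ℕ) (u : U) : 0 ≤ D.upperFn G l N u 0 :=
  D.upperFn_nonneg G (by simp) N u

end Potential

variable {S Act M : Type*} [Fintype S] [Fintype Act]

theorem tsum_jumpDensity_mul (C : CTMDP S Act) (x : Timing) (s : S) (p : ℝ → PMF (Act × M))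
    (r : ℝ) (f : S → ℝ≥0∞) :
    ∑' z : S × M, C.jumpDensity x s p r z.1 z.2 * f z.1 =
      ∑ a, ENNReal.ofReal (actionProb (p r) a) *
        ∑ s', ENNReal.ofReal (C.rate s a s' * Real.exp (-C.hazard x s p a r)) * f s' := by
  rw [ENNReal.tsum_prod', tsum_fintype]
  have : ∀ s', ∑' m', C.jumpDensity x s p r s' m' * f s' =
      ∑ a, ENNReal.ofReal (actionProb (p r) a) *
        (ENNReal.ofReal (C.rate s a s' * Real.exp (-C.hazard x s p a r)) * f s') := by
    intro s'
    simp only [jumpDensity]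
    rw [ENNReal.tsum_mul_right, Summable.tsum_finsetSum fun _ _ => ENNReal.summable,
      Finset.sum_mul]
    refine Finset.sum_congr rfl fun a _ => ?_
    rw [ENNReal.tsum_mul_right, ofReal_actionProb, mul_assoc]
  simp only [this]
  rw [Finset.sum_comm]
  simp only [Finset.mul_sum]

theorem tsum_jumpDensity_mul_ofReal (C : CTMDP S Act) (x : Timing) (s : S)
    (p : ℝ → PMF (Act × M)) (r : ℝ) {f : S → ℝ} (hf : ∀ s, 0 ≤ f s) :
    ∑' z : S × M, C.jumpDensity x s p r z.1 z.2 * ENNReal.ofReal (f z.1) =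
      ∑ a, ENNReal.ofReal (actionProb (p r) a) * ENNReal.ofReal
        ((∑ s', C.rate s a s' * f s') * Real.exp (-C.hazard x s p a r)) := by
  rw [tsum_jumpDensity_mul C x s p r fun s => ENNReal.ofReal (f s)]
  refine Finset.sum_congr rfl fun a _ => ?_
  congr 1
  rw [Finset.sum_mul, ENNReal.ofReal_sum_of_nonneg]
  · refine Finset.sum_congr rfl fun s' _ => ?_
    rw [← ENNReal.ofReal_mul' (hf s')]
    congr 1
    ring
  · exact fun s' _ => mul_nonneg (mul_nonneg (C.rate_nonneg _ _ _) (hf s')) (Real.exp_pos _).le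

theorem sum_actionProb (p : PMF (Act × M)) : ∑ a, actionProb p a = 1 := by
  have h : ∑ a, p.map Prod.fst a = 1 :=
    (tsum_fintype _).symm.trans (PMF.tsum_coe _)
  simp only [actionProb]
  rw [← ENNReal.toReal_sum fun a _ => PMF.apply_ne_top _ a, h, ENNReal.toReal_one]

omit [Fintype Act] in
theorem actionProb_eq_zero {p : PMF (Act × M)} {a : Act} (h : ∀ m, p (a, m) = 0) :
    actionProb p a = 0 := by
  rw [actionProb, map_fst_apply]
  simp [h]

/-- No randomisation over actions and no revision of them while time passes beats the upper
bound of the late uniformisation. -/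
theorem late_lintegral_upperFn_le [Countable M] (C : CTMDP S Act) {l : ℝ} (hl : C.maxExit ≤ l)
    (G : Set S) (N : ℕ) {s : S} (hs : s ∉ G) {p : ℝ → PMF (Act × M)}
    (hp : ∀ q, Measurable fun t => p t q)
    (hen : ∀ t a m, a ∉ C.enabled s → p t (a, m) = 0) {t : ℝ} (ht : 0 ≤ t) :
    ∫⁻ r in Set.Ioc 0 t, ∑' z : S × M, C.jumpDensity .late s p r z.1 z.2 *
        ENNReal.ofReal ((C.lateUnif l hl).upperFn G l N z.1 (t - r)) ≤
      ENNReal.ofReal ((C.lateUnif l hl).upperFn G l N s t) := by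
  have hl0 : 0 ≤ l := C.maxExit_nonneg.trans hl
  set V := (C.lateUnif l hl).upperFn G l N with hV
  set η : ℝ → ℝ := fun r => ∑ b, actionProb (p r) b * C.exit s b with hη
  set θ : ℝ → ℝ := fun r => ∑ a, actionProb (p r) a * ∑ s', C.rate s a s' * V s' (t - r) with hθ
  have hV0 : ∀ r ∈ Set.Ioc 0 t, ∀ s, 0 ≤ V s (t - r) := fun r hr s =>
    upperFn_nonneg _ G (mul_nonneg hl0 (sub_nonneg.2 hr.2)) N s
  have hsum0 : ∀ r ∈ Set.Ioc 0 t, ∀ a, 0 ≤ ∑ s', C.rate s a s' * V s' (t - r) := fun r hr a =>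
    Finset.sum_nonneg fun s' _ => mul_nonneg (C.rate_nonneg _ _ _) (hV0 r hr s')
  refine le_trans (le_of_eq ?_) (lintegral_hazard_le (K := ∑ b, C.exit s b) (η := η) (θ := θ)
    (g := V s) ht
    (Finset.measurable_sum _ fun b _ => (measurable_actionProb hp b).mul_const _)
    (fun r => Finset.sum_nonneg fun b _ => mul_nonneg (actionProb_nonneg _ _) (C.exit_nonneg _ _))
    (fun r => Finset.sum_le_sum fun b _ =>
        mul_le_of_le_one_left (C.exit_nonneg _ _) (actionProb_le_one _ _))
    (contDiff_upperFn _ G l N s) (upperFn_zero_nonneg _ G l N s) ?_ ?_)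
  · refine setLIntegral_congr_fun measurableSet_Ioc fun r hr => ?_
    rw [tsum_jumpDensity_mul_ofReal C .late s p r (hV0 r hr), hθ]
    simp only [hazard]
    rw [Finset.sum_mul, ENNReal.ofReal_sum_of_nonneg]
    · refine Finset.sum_congr rfl fun a _ => ?_
      rw [← ENNReal.ofReal_mul (actionProb_nonneg _ _), mul_assoc]
    · exact fun a _ => mul_nonneg (mul_nonneg (actionProb_nonneg _ _) (hsum0 r hr a))
        (Real.exp_pos _).le
  · exact fun r hr => Finset.sum_nonneg fun a _ =>
      mul_nonneg (actionProb_nonneg _ _) (hsum0 r hr a)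
  · intro r hr
    have h1 : ∀ a, actionProb (p r) a * ∑ s', C.rate s a s' * V s' (t - r) ≤
        actionProb (p r) a * (deriv (V s) (t - r) + C.exit s a * V s (t - r)) := by
      intro a
      by_cases ha : a ∈ C.enabled s
      · refine mul_le_mul_of_nonneg_left ?_ (actionProb_nonneg _ _)
        have h2 := sum_rate_upperFn_le (C.lateUnif l hl) G
          (mul_nonneg hl0 (sub_nonneg.2 hr.2)) hl0 N hs ha (C.lateUnif_exit hl ha)
        rw [C.lateUnif_sum_rate hl ha fun v => upperFn _ G l N v (t - r)] at h2
        simp only [hV]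
        linarith
      · rw [actionProb_eq_zero fun m => hen r a m ha, zero_mul, zero_mul]
    refine (Finset.sum_le_sum fun a _ => h1 a).trans (le_of_eq ?_)
    simp only [mul_add, Finset.sum_add_distrib, ← Finset.sum_mul, sum_actionProb, hη, one_mul,
      ← mul_assoc]

theorem upperFn_early_some_le (C : CTMDP S Act) {l : ℝ} (hl : C.maxExit ≤ l)
    (G : Set S) (N : ℕ) {s : S} {a : Act} (ha : a ∈ C.enabled s) {t : ℝ} (ht : 0 ≤ t) :
    (C.earlyUnif l hl).upperFn (earlyGoal Act G) l N (s, some a) t ≤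
      (C.earlyUnif l hl).upperFn (earlyGoal Act G) l N (s, none) t := by
  have hl0 : 0 ≤ l := C.maxExit_nonneg.trans hl
  set D := C.earlyUnif l hl with hD
  by_cases hs : s ∈ G
  · rw [D.upperFn_of_mem _ (u := (s, some a)) hs, D.upperFn_of_mem _ (u := (s, none)) hs]
  · have hen : a ∈ D.enabled (s, none) := ha
    have hen' : a ∈ D.enabled (s, some a) := Finset.mem_singleton_self a
    refine sub_le_sub_left (Finset.sum_le_sum fun i _ => ?_) _
    refine mul_le_mul_of_nonneg_left (sub_le_sub_left ?_ _) (pois_nonneg (mul_nonneg hl0 ht) i)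
    rw [D.reachRem_succ_of_notMem _ (u := (s, some a)) hs]
    refine D.bellman_le _ fun b hb => ?_
    obtain rfl : b = a := Finset.mem_singleton.1 hb
    have e : ∀ v, D.prob (s, some b) b v = D.prob (s, none) b v := by
      intro v
      rw [prob, prob, C.earlyUnif_exit hl hen, C.earlyUnif_exit hl hen']
      congr 1
      have hb1 : b ∈ (some b).elim (C.enabled s) fun c => {c} := hen'
      have hb2 : b ∈ (none : Option Act).elim (C.enabled s) fun c => {c} := hen
      simp only [hD, earlyUnif, hb1, hb2, if_true]
    simp only [e]
    exact D.sum_prob_reachRem_le (earlyGoal Act G) (u := (s, none)) hs hen i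

/-- No randomisation over the actions on entry beats the upper bound of the early
uniformisation. -/
theorem early_lintegral_upperFn_le (C : CTMDP S Act) {l : ℝ} (hl : C.maxExit ≤ l)
    (G : Set S) (N : ℕ) {s : S} (hs : s ∉ G) {p : ℝ → PMF (Act × M)}
    (hen : ∀ t a m, a ∉ C.enabled s → p t (a, m) = 0)
    (he : ∀ t t', 0 ≤ t → 0 ≤ t' → (p t).map Prod.fst = (p t').map Prod.fst)
    {t : ℝ} (ht : 0 ≤ t) :
    ∫⁻ r in Set.Ioc 0 t, ∑' z : S × M, C.jumpDensity .early s p r z.1 z.2 *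
        ENNReal.ofReal ((C.earlyUnif l hl).upperFn (earlyGoal Act G) l N (z.1, none) (t - r)) ≤
      ENNReal.ofReal ((C.earlyUnif l hl).upperFn (earlyGoal Act G) l N (s, none) t) := by
  have hl0 : 0 ≤ l := C.maxExit_nonneg.trans hl
  set V := (C.earlyUnif l hl).upperFn (earlyGoal Act G) l N with hV
  have hV0 : ∀ r ∈ Set.Ioc 0 t, ∀ s, 0 ≤ V s (t - r) := fun r hr s =>
    upperFn_nonneg _ _ (mul_nonneg hl0 (sub_nonneg.2 hr.2)) N s
  have hc : ∀ u, Continuous (V u) := fun u => (contDiff_upperFn _ _ l N u).continuous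
  have h1 : ∀ r ∈ Set.Ioc 0 t, ∑' z : S × M, C.jumpDensity .early s p r z.1 z.2 *
        ENNReal.ofReal (V (z.1, none) (t - r)) = ∑ a, ENNReal.ofReal (actionProb (p 0) a) *
          ENNReal.ofReal ((∑ s', C.rate s a s' * V (s', none) (t - r)) *
            Real.exp (-(C.exit s a * r))) := by
    intro r hr
    rw [tsum_jumpDensity_mul_ofReal C .early s p r fun s => hV0 r hr (s, none)]
    refine Finset.sum_congr rfl fun a _ => ?_
    simp only [actionProb, hazard]
    rw [he r 0 hr.1.le le_rfl]
  rw [setLIntegral_congr_fun measurableSet_Ioc h1, lintegral_finsetSum]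
  · have h2 : ∀ a, ∫⁻ r in Set.Ioc 0 t, ENNReal.ofReal (actionProb (p 0) a) *
        ENNReal.ofReal ((∑ s', C.rate s a s' * V (s', none) (t - r)) *
            Real.exp (-(C.exit s a * r))) ≤
        ENNReal.ofReal (actionProb (p 0) a) * ENNReal.ofReal (V (s, none) t) := by
      intro a
      by_cases ha : a ∈ C.enabled s
      · rw [lintegral_const_mul' _ _ ENNReal.ofReal_ne_top]
        refine mul_le_mul_right ?_ _
        refine le_trans ?_ (ENNReal.ofReal_le_ofReal (C.upperFn_early_some_le hl G N ha ht))
        have h3 := lintegral_hazard_le (K := C.exit s a) (η := fun _ => C.exit s a)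
          (θ := fun r => ∑ s', C.rate s a s' * V (s', none) (t - r)) (g := V (s, some a)) ht
          measurable_const (fun _ => C.exit_nonneg s a) (fun _ => le_rfl)
          (contDiff_upperFn _ _ l N _) (upperFn_zero_nonneg _ _ l N _)
          (fun r hr => Finset.sum_nonneg fun s' _ => mul_nonneg (C.rate_nonneg _ _ _)
            (hV0 r hr (s', none))) ?_
        · simpa [mul_comm] using h3
        · intro r hr
          have hen' : a ∈ (C.earlyUnif l hl).enabled (s, some a) := Finset.mem_singleton_self a
          have h4 := sum_rate_upperFn_le (C.earlyUnif l hl) (earlyGoal Act G) (u := (s, some a))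
            (mul_nonneg hl0 (sub_nonneg.2 hr.2)) hl0 N hs hen' (C.earlyUnif_exit hl hen')
          rw [C.earlyUnif_sum_rate hl hen' fun v => upperFn _ _ l N v (t - r)] at h4
          simp only [hV]
          linarith
      · rw [actionProb_eq_zero fun m => hen 0 a m ha]
        simp
    refine (Finset.sum_le_sum fun a _ => h2 a).trans (le_of_eq ?_)
    rw [← Finset.sum_mul, ← ENNReal.ofReal_sum_of_nonneg fun a _ => actionProb_nonneg _ _,
      sum_actionProb, ENNReal.ofReal_one, one_mul]
  · intro a _
    refine Measurable.const_mul (Measurable.ennreal_ofReal ?_) _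
    refine Continuous.measurable (Continuous.mul ?_ (by fun_prop))
    exact continuous_finsetSum _ fun s' _ => continuous_const.mul ((hc _).comp (by fun_prop))

variable [MeasurableSpace S] [DiscreteMeasurableSpace S]

theorem value_le_late (C : CTMDP S Act) {l : ℝ} (hl : C.maxExit ≤ l) (G : Set S) {T : ℝ}
    (hT : 0 ≤ T) (N : ℕ) (s : S) :
    C.value .late G T s ≤ (C.lateUnif l hl).upperFn G l N s T := by
  have hl0 : 0 ≤ l := C.maxExit_nonneg.trans hl
  have h0 := upperFn_nonneg (C.lateUnif l hl) G (mul_nonneg hl0 hT) N s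
  refine Real.iSup_le (fun σ => ?_) h0
  refine ENNReal.toReal_le_of_le_ofReal h0 ?_
  refine σ.runMeasure_reach_le G hT
    (V := fun s t => ENNReal.ofReal ((C.lateUnif l hl).upperFn G l N s t))
    (fun s => (contDiff_upperFn _ G l N s).continuous.measurable.ennreal_ofReal)
    (fun s hs t => by rw [upperFn_of_mem _ G hs, ENNReal.ofReal_one]) (fun n h hG t ht => ?_) s
  exact C.late_lintegral_upperFn_le hl G N hG
    (fun q => (σ.measurable_decision n q).comp measurable_prodMk_left)
    (σ.decision_enabled n h) ht

theorem value_le_early (C : CTMDP S Act) {l : ℝ} (hl : C.maxExit ≤ l) (G : Set S) {T : ℝ}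
    (hT : 0 ≤ T) (N : ℕ) (s : S) :
    C.value .early G T s ≤ (C.earlyUnif l hl).upperFn (earlyGoal Act G) l N (s, none) T := by
  have hl0 : 0 ≤ l := C.maxExit_nonneg.trans hl
  have h0 := upperFn_nonneg (C.earlyUnif l hl) (earlyGoal Act G) (mul_nonneg hl0 hT) N (s, none)
  refine Real.iSup_le (fun σ => ?_) h0
  refine ENNReal.toReal_le_of_le_ofReal h0 ?_
  refine σ.runMeasure_reach_le G hT
    (V := fun s t => ENNReal.ofReal
      ((C.earlyUnif l hl).upperFn (earlyGoal Act G) l N (s, none) t))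
    (fun s => (contDiff_upperFn _ _ l N _).continuous.measurable.ennreal_ofReal)
    (fun s hs t => by
      rw [upperFn_of_mem _ (earlyGoal Act G) (u := (s, none)) hs, ENNReal.ofReal_one])
    (fun n h hG t ht => ?_) s
  exact C.early_lintegral_upperFn_le hl G N hG (σ.decision_enabled n h)
    (σ.decision_early rfl n h) ht

end Upper

/-! ### Exponential power series -/

section Series

/-- The exponential generating function `∑ t ^ n / n! * c n` of the sequence `c`. -/
noncomputable def expSeries (c : ℕ → ℝ) (t : ℝ) : ℝ := ∑' n : ℕ, t ^ n / n ! * c n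

theorem summable_expSeries {c : ℕ → ℝ} {K l : ℝ} (hc : ∀ n, |c n| ≤ K * l ^ n) (t : ℝ) :
    Summable fun n : ℕ => t ^ n / n ! * c n := by
  refine Summable.of_norm_bounded (g := fun n : ℕ => K * ((|t| * l) ^ n / n !))
    ((Real.summable_pow_div_factorial _).mul_left K) fun n => ?_
  rw [Real.norm_eq_abs, abs_mul, abs_div, abs_pow, Nat.abs_cast]
  calc |t| ^ n / n ! * |c n| ≤ |t| ^ n / n ! * (K * l ^ n) := by gcongr; exact hc n
    _ = K * ((|t| * l) ^ n / n !) := by ring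

theorem hasDerivAt_expSeries {c : ℕ → ℝ} {K l : ℝ} (hc : ∀ n, |c n| ≤ K * l ^ n)
    (t : ℝ) : HasDerivAt (expSeries c) (expSeries (fun n => c (n + 1)) t) t := by
  have hc' : ∀ n, |c (n + 1)| ≤ K * l * l ^ n := fun n => by
    have := hc (n + 1); rw [pow_succ] at this; linarith
  have hK : 0 ≤ K := by simpa using (abs_nonneg _).trans (hc 0)
  set R := |t| + 1 with hR
  have hR0 : 0 ≤ R := by positivity
  -- the derivative of the term `n + 1` is the term `n` of the shifted series
  have hder : HasDerivAt (fun y : ℝ => ∑' n : ℕ, y ^ (n + 1) / (n + 1)! * c (n + 1))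
      (∑' n : ℕ, t ^ n / n ! * c (n + 1)) t := by
    refine hasDerivAt_tsum_of_isPreconnected (𝕜 := ℝ) (F := ℝ)
      (g := fun (n : ℕ) y => y ^ (n + 1) / (n + 1)! * c (n + 1))
      (g' := fun (n : ℕ) y => y ^ n / n ! * c (n + 1)) (y := t) (u := fun n : ℕ => K * l * ((R * l) ^ n / n !))
      (t := Metric.ball (0 : ℝ) R) (y₀ := 0)
      ((Real.summable_pow_div_factorial _).mul_left _) Metric.isOpen_ball
      (convex_ball (0 : ℝ) R).isPreconnected (fun n y _ => ?_) (fun n y hy => ?_) ?_ ?_ ?_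
    · have h := ((hasDerivAt_pow (n + 1) y).div_const ((n + 1)! : ℝ)).mul_const (c (n + 1))
      convert! h using 1
      rw [Nat.factorial_succ, Nat.add_sub_cancel]
      have h3 : ((n ! : ℕ) : ℝ) ≠ 0 := by positivity
      have h4 : ((n : ℝ) + 1) ≠ 0 := by positivity
      push_cast
      field_simp
    · have hy' : |y| ≤ R := by
        rw [mem_ball_zero_iff, Real.norm_eq_abs] at hy; exact hy.le
      rw [Real.norm_eq_abs, abs_mul, abs_div, abs_pow, Nat.abs_cast]
      calc |y| ^ n / n ! * |c (n + 1)| ≤ R ^ n / n ! * (K * l * l ^ n) := by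
            gcongr; exact hc' n
        _ = K * l * ((R * l) ^ n / n !) := by rw [mul_pow]; ring
    · simp [hR]; positivity
    · simp
    · simp [hR]
  have h0 : expSeries c = fun y => c 0 + ∑' n : ℕ, y ^ (n + 1) / (n + 1)! * c (n + 1) := by
    funext y
    rw [expSeries, (summable_expSeries hc y).tsum_eq_zero_add]
    simp
  rw [h0]
  exact hder.const_add (c 0)

theorem continuous_expSeries {c : ℕ → ℝ} {K l : ℝ} (hc : ∀ n, |c n| ≤ K * l ^ n) :
    Continuous (expSeries c) :=
  continuous_iff_continuousAt.2 fun t => (hasDerivAt_expSeries hc t).continuousAt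

theorem expSeries_pow (ρ t : ℝ) : expSeries (fun n => ρ ^ n) t = Real.exp (t * ρ) := by
  rw [Real.exp_eq_exp_ℝ, ← (NormedSpace.expSeries_div_hasSum_exp (t * ρ)).tsum_eq]
  exact tsum_congr fun n => by rw [mul_pow]; ring

theorem one_le_expSeries {c : ℕ → ℝ} {K l : ℝ} (hc : ∀ n, |c n| ≤ K * l ^ n)
    (hc0 : c 0 = 1) (hnn : ∀ n, 0 ≤ c n) {t : ℝ} (ht : 0 ≤ t) : 1 ≤ expSeries c t := by
  have := (summable_expSeries hc t).sum_le_tsum {0} fun n _ =>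
    mul_nonneg (by positivity) (hnn n)
  simpa [expSeries, hc0] using this

end Series

/-! ### The jump density of the counting scheduler -/

section CountDensity

variable {S Act : Type*} [Fintype S] [Fintype Act] (C : CTMDP S Act) (x : Timing) {l : ℝ}
  (hl : C.maxExit ≤ l) (d : ℕ → (s : S) → C.enabled s) (m : ℕ) (s : S)

/-- The product of the first `j` rates of simulated self-loops. -/
noncomputable def loopProd (l : ℝ) (j : ℕ) : ℝ := ∏ i ∈ Finset.range j, C.loopRate x l d m s i

include hl in
theorem loopProd_nonneg (j : ℕ) : 0 ≤ C.loopProd x d m s l j :=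
  Finset.prod_nonneg fun i _ => C.loopRate_nonneg x hl d m s i

include hl in
theorem abs_loopProd_le (j : ℕ) : |C.loopProd x d m s l j| ≤ 1 * l ^ j := by
  rw [abs_of_nonneg (C.loopProd_nonneg x hl d m s j), one_mul]
  simpa [loopProd] using Finset.prod_le_prod (s := Finset.range j)
    (fun i _ => C.loopRate_nonneg x hl d m s i) (fun i _ => C.loopRate_le x d m s i)

omit [Fintype Act] in
theorem loopProd_succ (j : ℕ) : C.loopProd x d m s l (j + 1) =
    C.loopProd x d m s l j * C.loopRate x l d m s j := Finset.prod_range_succ _ _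

include hl in
theorem expSeries_loopProd_pos {t : ℝ} (ht : 0 ≤ t) : 0 < expSeries (C.loopProd x d m s l) t :=
  zero_lt_one.trans_le (one_le_expSeries (C.abs_loopProd_le x hl d m s) (by simp [loopProd])
    (C.loopProd_nonneg x hl d m s) ht)

theorem loopCount_apply {t : ℝ} (ht : 0 ≤ t) (j : ℕ) :
    C.loopCount x l hl d m s t j = ENNReal.ofReal
      (t ^ j / j ! * C.loopProd x d m s l j / expSeries (C.loopProd x d m s l) t) := by
  have h : ∑' n, loopWeight (C.loopRate x l d m s) t n =
      ENNReal.ofReal (expSeries (C.loopProd x d m s l) t) := by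
    rw [expSeries, ENNReal.ofReal_tsum_of_nonneg]
    · rfl
    · exact fun n => mul_nonneg (by positivity) (C.loopProd_nonneg x hl d m s n)
    · exact summable_expSeries (C.abs_loopProd_le x hl d m s) t
  rw [loopCount, PMF.normalize_apply, h,
    ENNReal.ofReal_div_of_pos (C.expSeries_loopProd_pos x hl d m s ht), ENNReal.div_eq_inv_mul,
    mul_comm]
  rfl

/-- The expected exit rate under the late counting scheduler, as a logarithmic derivative. -/
theorem sum_actionProb_countScheduler_late {t : ℝ} (ht : 0 ≤ t) :
    ∑ b, actionProb ((C.countScheduler .late l hl d).update m s t) b * C.exit s b =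
      l - expSeries (fun n => C.loopProd .late d m s l (n + 1)) t /
        expSeries (C.loopProd .late d m s l) t := by
  classical
  set Z := expSeries (C.loopProd .late d m s l) t with hZ
  have hZ0 : 0 < Z := C.expSeries_loopProd_pos .late hl d m s ht
  set q : ℕ → ℝ := fun j => t ^ j / j ! * C.loopProd .late d m s l j / Z with hq
  have hq0 : ∀ j, 0 ≤ q j := fun j =>
    div_nonneg (mul_nonneg (by positivity) (C.loopProd_nonneg .late hl d m s j)) hZ0.le
  have hqs : Summable q := (summable_expSeries (C.abs_loopProd_le .late hl d m s) t).div_const Z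
  have hq1 : ∑' j, q j = 1 := by
    rw [hq, tsum_div_const]
    exact div_self hZ0.ne'
  have hact : ∀ b, actionProb ((C.countScheduler .late l hl d).update m s t) b =
      ∑' j, if b = d (m + j) s then q j else 0 := by
    intro b
    have h1 : (PMF.map Prod.fst ((C.countScheduler .late l hl d).update m s t)) b =
        ∑' j, if b = d (m + j) s then ENNReal.ofReal (q j) else 0 := by
      simp only [countScheduler, PMF.map_comp, PMF.map_apply, Function.comp]
      refine tsum_congr fun j => ?_
      rw [C.loopCount_apply .late hl d m s ht]
      rfl
    rw [actionProb, h1, ENNReal.tsum_toReal_eq]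
    · refine tsum_congr fun j => ?_
      split_ifs
      · exact ENNReal.toReal_ofReal (hq0 j)
      · rfl
    · intro j
      split_ifs
      · exact ENNReal.ofReal_ne_top
      · exact ENNReal.zero_ne_top
  have hsum : ∀ b : Act, Summable fun j => (if b = d (m + j) s then q j else 0) * C.exit s b := by
    intro b
    refine Summable.mul_right _ (Summable.of_nonneg_of_le (fun j => ?_) (fun j => ?_) hqs)
    · split_ifs
      · exact hq0 j
      · exact le_rfl
    · split_ifs
      · exact le_rfl
      · exact hq0 j
  simp only [hact, ← tsum_mul_right]
  rw [← Summable.tsum_finsetSum fun b _ => hsum b]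
  have h2 : ∀ j, ∑ b : Act, (if b = d (m + j) s then q j else 0) * C.exit s b =
      q j * l - t ^ j / j ! * C.loopProd .late d m s l (j + 1) / Z := by
    intro j
    simp only [ite_mul, zero_mul, Finset.sum_ite_eq', mem_univ, if_true]
    rw [loopProd_succ]
    simp only [hq, loopRate]
    ring
  have hc' : ∀ n, |C.loopProd .late d m s l (n + 1)| ≤ l * l ^ n := fun n => by
    have := C.abs_loopProd_le .late hl d m s (n + 1); rw [pow_succ] at this; linarith
  simp only [h2]
  rw [Summable.tsum_sub (hqs.mul_right l) ((summable_expSeries hc' t).div_const Z),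
    tsum_mul_right, hq1, one_mul, tsum_div_const]
  rfl

/-- Until time `t` the state is not left with probability `e^{-l t} ∑ t ^ n / n! ∏ r_i`, the
probability that the uniformised model makes only self-loops. -/
theorem exp_neg_hazard_countScheduler {t : ℝ} (ht : 0 ≤ t) (j : ℕ) :
    Real.exp (-C.hazard x s ((C.countScheduler x l hl d).update m s) (C.simAction x d m s j) t) =
      Real.exp (-(l * t)) * expSeries (C.loopProd x d m s l) t := by
  have hl0 : 0 ≤ l := C.maxExit_nonneg.trans hl
  cases x with
  | late =>
    set Z := expSeries (C.loopProd .late d m s l) with hZ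
    have hb := C.abs_loopProd_le .late hl d m s
    have hc' : ∀ n, |C.loopProd .late d m s l (n + 1)| ≤ l * l ^ n := fun n => by
      have := hb (n + 1); rw [pow_succ] at this; linarith
    have hpos : ∀ u, 0 ≤ u → 0 < Z u := fun u hu => C.expSeries_loopProd_pos .late hl d m s hu
    have hftc : ∫ u in (0 : ℝ)..t, (l - expSeries (fun n => C.loopProd .late d m s l (n + 1)) u /
        Z u) = (l * t - Real.log (Z t)) - (l * 0 - Real.log (Z 0)) := by
      refine intervalIntegral.integral_eq_sub_of_hasDerivAt
        (f := fun u => l * u - Real.log (Z u)) (fun u hu => ?_) ?_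
      · rw [Set.uIcc_of_le ht] at hu
        have h1 := (hasDerivAt_expSeries hb u).log (hpos u hu.1).ne'
        have h2 : HasDerivAt (fun u : ℝ => l * u) l u := by
          simpa using (hasDerivAt_id u).const_mul l
        exact h2.sub h1
      · refine ContinuousOn.intervalIntegrable ?_
        rw [Set.uIcc_of_le ht]
        refine continuousOn_const.sub (ContinuousOn.div
          (continuous_expSeries hc').continuousOn (continuous_expSeries hb).continuousOn
          fun u hu => (hpos u hu.1).ne')
    have hZ0 : Z 0 = 1 := by
      rw [hZ, expSeries, tsum_eq_single 0]
      · simp [loopProd]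
      · intro n hn
        simp [hn]
    have hhaz : C.hazard .late s ((C.countScheduler .late l hl d).update m s)
        (C.simAction .late d m s j) t = l * t - Real.log (Z t) := by
      rw [hZ0, Real.log_one] at hftc
      simp only [hazard]
      rw [intervalIntegral.integral_congr (g := fun u =>
        l - expSeries (fun n => C.loopProd .late d m s l (n + 1)) u / Z u), hftc]
      · ring
      · intro u hu
        rw [Set.uIcc_of_le ht] at hu
        exact C.sum_actionProb_countScheduler_late hl d m s hu.1
    rw [hhaz, neg_sub, sub_eq_add_neg, add_comm, Real.exp_add, Real.exp_log (hpos t ht)]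
  | early =>
    have h1 : C.loopProd .early d m s l = fun n => (l - C.exit s (d m s)) ^ n := by
      funext n; simp [loopProd, loopRate]
    rw [h1, expSeries_pow, ← Real.exp_add]
    congr 1
    simp only [hazard, simAction]
    ring

/-- The counting scheduler leaves `s` at time `t` after `j` simulated self-loops with the same
density as the uniformised model. -/
theorem le_jumpDensity_countScheduler {t : ℝ} (ht : 0 ≤ t) (j : ℕ) (s' : S) :
    ENNReal.ofReal (C.rate s (C.simAction x d m s j) s' *
        phaseProb l (C.loopRate x l d m s) j t) ≤
      C.jumpDensity x s ((C.countScheduler x l hl d).update m s) t s' (m + j + 1) := by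
  classical
  have hZ := C.expSeries_loopProd_pos x hl d m s ht
  have h1 : C.loopCount x l hl d m s t j ≤ (C.countScheduler x l hl d).update m s t
      (C.simAction x d m s j, m + j + 1) := by
    simp only [countScheduler, PMF.map_apply]
    refine le_trans (le_of_eq ?_) (ENNReal.le_tsum j)
    rw [if_pos rfl]
  refine le_trans ?_ (Finset.single_le_sum (f := fun a =>
    (C.countScheduler x l hl d).update m s t (a, m + j + 1) * ENNReal.ofReal (C.rate s a s' *
      Real.exp (-C.hazard x s ((C.countScheduler x l hl d).update m s) a t)))
    (fun a _ => zero_le) (mem_univ (C.simAction x d m s j)))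
  refine le_trans (le_of_eq ?_) (mul_le_mul_left h1 _)
  rw [C.loopCount_apply x hl d m s ht, C.exp_neg_hazard_countScheduler x hl d m s ht,
    ← ENNReal.ofReal_mul]
  · congr 1
    rw [phaseProb, ← loopProd]
    field_simp
  · exact div_nonneg (mul_nonneg (by positivity) (C.loopProd_nonneg x hl d m s j)) hZ.le

/-- A family `W` (indexed by a step budget, the memory and the state) whose values over the phases
of a sojourn in `s` satisfy the evolution equation `hf` cannot decrease in expectation at a jump
of the process controlled by the counting scheduler. -/
theorem le_lintegral_jumpDensity_countScheduler {t : ℝ} (ht : 0 ≤ t) (k : ℕ)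
    {W : ℕ → ℕ → S → ℝ → ℝ} (hW0 : ∀ n m s u, 0 ≤ u → 0 ≤ W n m s u)
    (hWm : ∀ n n' m s u, 0 ≤ u → n ≤ n' → W n m s u ≤ W n' m s u)
    (hWc : ∀ n m s, Continuous (W n m s)) {f : ℕ → ℝ → ℝ}
    (hf : ∀ j < k + 1, ∀ u, HasDerivAt (f j)
      (∑ s', C.rate s (C.simAction x d m s j) s' * W (k - j) (m + j + 1) s' u +
        C.loopRate x l d m s j * f (j + 1) u - l * f j u) u)
    (hn : ∀ u, f (k + 1) u = 0) (h0 : ∀ j, f j 0 = 0) :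
    ENNReal.ofReal (f 0 t) ≤ ∫⁻ r in Set.Ioc 0 t, ∑' z : S × ℕ,
      C.jumpDensity x s ((C.countScheduler x l hl d).update m s) r z.1 z.2 *
        ENNReal.ofReal (W k z.2 z.1 (t - r)) := by
  set X : ℕ → ℝ → ℝ := fun j u =>
    ∑ s', C.rate s (C.simAction x d m s j) s' * W (k - j) (m + j + 1) s' u with hX
  set g := phaseProb l (C.loopRate x l d m s) with hg
  have hXc : ∀ j, Continuous (X j) := fun j =>
    continuous_finsetSum _ fun s' _ => continuous_const.mul (hWc _ _ _)
  have hint := eq_integral_phaseProb t (C.loopRate x l d m s) hf hn h0 hXc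
  have hg0 : ∀ j u, 0 ≤ u → 0 ≤ g j u := fun j u hu =>
    phaseProb_nonneg l (C.loopRate_nonneg x hl d m s) j hu
  have hX0 : ∀ j u, 0 ≤ u → 0 ≤ X j u := fun j u hu =>
    Finset.sum_nonneg fun s' _ => mul_nonneg (C.rate_nonneg _ _ _) (hW0 _ _ _ _ hu)
  have hcont : Continuous fun u => ∑ j ∈ Finset.range (k + 1), g j u * X j (t - u) :=
    continuous_finsetSum _ fun j _ =>
      (contDiff_phaseProb l _ j).continuous.mul ((hXc j).comp (by fun_prop))
  rw [hint, intervalIntegral.integral_of_le ht, ofReal_integral_eq_lintegral_ofReal]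
  · refine setLIntegral_mono_ae' measurableSet_Ioc (ae_of_all _ fun r hr => ?_)
    have hr0 : 0 ≤ t - r := sub_nonneg.2 hr.2
    rw [ENNReal.tsum_prod', tsum_fintype]
    have hle : ∀ s', ∑ j ∈ Finset.range (k + 1), ENNReal.ofReal
        (C.rate s (C.simAction x d m s j) s' * g j r * W (k - j) (m + j + 1) s' (t - r)) ≤
        ∑' m', C.jumpDensity x s ((C.countScheduler x l hl d).update m s) r s' m' *
          ENNReal.ofReal (W k m' s' (t - r)) := by
      intro s'
      have hinj : Function.Injective fun j : ℕ => m + j + 1 := fun a b h => by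
        simp only at h; omega
      refine le_trans ?_ (ENNReal.tsum_comp_le_tsum_of_injective hinj _)
      refine le_trans ?_ (ENNReal.sum_le_tsum (Finset.range (k + 1)))
      refine Finset.sum_le_sum fun j _ => ?_
      rw [ENNReal.ofReal_mul (mul_nonneg (C.rate_nonneg _ _ _) (hg0 j r hr.1.le))]
      exact mul_le_mul' (C.le_jumpDensity_countScheduler x hl d m s hr.1.le j s')
        (ENNReal.ofReal_le_ofReal (hWm _ _ _ _ _ hr0 (Nat.sub_le k j)))
    refine le_trans (le_of_eq ?_) (Finset.sum_le_sum fun s' _ => hle s')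
    rw [Finset.sum_comm, ENNReal.ofReal_sum_of_nonneg fun j _ =>
      mul_nonneg (hg0 j r hr.1.le) (hX0 j _ hr0)]
    refine Finset.sum_congr rfl fun j _ => ?_
    rw [← ENNReal.ofReal_sum_of_nonneg fun s' _ => mul_nonneg
      (mul_nonneg (C.rate_nonneg _ _ _) (hg0 j r hr.1.le)) (hW0 _ _ _ _ hr0), hX, Finset.mul_sum]
    congr 1
    exact Finset.sum_congr rfl fun s' _ => by ring
  · exact (hcont.integrableOn_Icc (a := 0) (b := t)).mono_set Set.Ioc_subset_Icc_self
  · rw [Filter.EventuallyLE, ae_restrict_iff' measurableSet_Ioc]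
    exact ae_of_all _ fun r hr => Finset.sum_nonneg fun j _ =>
      mul_nonneg (hg0 j r hr.1.le) (hX0 j _ (sub_nonneg.2 hr.2))

end CountDensity

/-! ### The lower bound for the counting scheduler -/

section Lower

section StepCounting

variable {U Act : Type*} [Fintype U] (D : CTMDP U Act) (G : Set U) (π : ℕ → U → Act)

open Classical in
/-- The probability to reach `G` within `i` steps from `u` under the step-counting scheduler `π`,
if `m` steps have been made before. -/
noncomputable def reachUnder : ℕ → ℕ → U → ℝ
  | 0 => fun _ u => if u ∈ G then 1 else 0
  | i + 1 => fun m u =>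
      if u ∈ G then 1 else ∑ v, D.prob u (π m u) v * reachUnder i (m + 1) v

theorem reachUnder_of_mem {u : U} (hu : u ∈ G) (i m : ℕ) : D.reachUnder G π i m u = 1 := by
  cases i <;> simp [reachUnder, hu]

theorem reachUnder_nonneg (i m : ℕ) (u : U) : 0 ≤ D.reachUnder G π i m u := by
  induction i generalizing m u with
  | zero => simp only [reachUnder]; split_ifs <;> norm_num
  | succ i ih =>
    simp only [reachUnder]
    split_ifs
    · exact zero_le_one
    · exact Finset.sum_nonneg fun v _ => mul_nonneg (D.prob_nonneg _ _ _) (ih _ _)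

theorem reachUnder_le_one (i m : ℕ) (u : U) : D.reachUnder G π i m u ≤ 1 := by
  induction i generalizing m u with
  | zero => simp only [reachUnder]; split_ifs <;> norm_num
  | succ i ih =>
    simp only [reachUnder]
    split_ifs
    · exact le_rfl
    · exact D.sum_prob_le _ _ zero_le_one fun v => ih _ _

/-- The lower bound is the performance of any scheduler that attains the maxima. -/
theorem lowerRem_eq_sum_reachUnder {w : ℕ → ℝ} {N : ℕ}
    (hπ : ∀ k < N, ∀ u ∉ G, ∑ v, D.prob u (π k u) v * D.lowerVal G w N (k + 1) v =
      D.lowerVal G w N k u) (r : ℕ) (hr : r ≤ N) (u : U) :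
    D.lowerRem G w N r u = ∑ i ∈ Finset.range r, w (N - r + i) * D.reachUnder G π i (N - r) u := by
  induction r generalizing u with
  | zero => simp [lowerRem]
  | succ r ih =>
    by_cases hu : u ∈ G
    · simp only [lowerRem, hu, if_true]
      rw [Finset.sum_Ico_eq_sum_range]
      have : N - (N - (r + 1)) = r + 1 := by omega
      rw [this]
      exact Finset.sum_congr rfl fun i _ => by rw [D.reachUnder_of_mem G π hu, mul_one]
    · have h1 := hπ (N - (r + 1)) (by omega) u hu
      have e1 : N - (N - (r + 1)) = r + 1 := by omega
      have e2 : N - (N - (r + 1) + 1) = r := by omega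
      have e3 : N - r = N - (r + 1) + 1 := by omega
      simp only [lowerVal, e1, e2] at h1
      rw [← h1, Finset.sum_range_succ']
      simp only [ih (by omega), reachUnder, hu, if_false, mul_zero, add_zero, Finset.mul_sum]
      rw [Finset.sum_comm]
      refine Finset.sum_congr rfl fun i _ => Finset.sum_congr rfl fun v _ => ?_
      have e4 : N - (r + 1) + (i + 1) = N - r + i := by omega
      rw [e4, ← e3]
      ring

/-- The probability that `u` reaches `G` within time `t`, fewer than `n` steps of the
uniformised model being made in this time, if `m` steps have been made before. -/
noncomputable def lowerFn (l : ℝ) (n m : ℕ) (u : U) (t : ℝ) : ℝ :=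
  poisSum l (fun i => D.reachUnder G π i m u) n t

theorem lowerFn_eq_lowerVal {l T : ℝ} {N : ℕ}
    (hπ : ∀ k < N, ∀ u ∉ G, ∑ v, D.prob u (π k u) v * D.lowerVal G (pois (l * T)) N (k + 1) v =
      D.lowerVal G (pois (l * T)) N k u) (u : U) :
    D.lowerFn G π l N 0 u T = D.lowerVal G (pois (l * T)) N 0 u := by
  rw [lowerVal, Nat.sub_zero, D.lowerRem_eq_sum_reachUnder G π hπ N le_rfl]
  simp [lowerFn, poisSum]

theorem lowerFn_zero (l : ℝ) (m : ℕ) (u : U) (t : ℝ) : D.lowerFn G π l 0 m u t = 0 := by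
  simp [lowerFn, poisSum]

theorem lowerFn_zero_right {u : U} (hu : u ∉ G) (l : ℝ) (n m : ℕ) :
    D.lowerFn G π l n m u 0 = 0 := by
  cases n with
  | zero => exact D.lowerFn_zero G π l m u 0
  | succ n => rw [lowerFn, poisSum_succ_zero]; simp [reachUnder, hu]

theorem lowerFn_nonneg {l t : ℝ} (h : 0 ≤ l * t) (n m : ℕ) (u : U) :
    0 ≤ D.lowerFn G π l n m u t :=
  poisSum_nonneg h (fun i => D.reachUnder_nonneg G π i m u) n

theorem lowerFn_le_one {l t : ℝ} (h : 0 ≤ l * t) (n m : ℕ) (u : U) :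
    D.lowerFn G π l n m u t ≤ 1 :=
  poisSum_le_one h (fun i => D.reachUnder_le_one G π i m u) n

theorem lowerFn_mono {l t : ℝ} (h : 0 ≤ l * t) {n n' : ℕ} (hn : n ≤ n') (m : ℕ) (u : U) :
    D.lowerFn G π l n m u t ≤ D.lowerFn G π l n' m u t :=
  poisSum_mono h (fun i => D.reachUnder_nonneg G π i m u) hn

theorem continuous_lowerFn (l : ℝ) (n m : ℕ) (u : U) : Continuous (D.lowerFn G π l n m u) :=
  (contDiff_poisSum l _ n).continuous

/-- The Kolmogorov backward equation for the step-counting scheduler. -/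
theorem hasDerivAt_lowerFn {l : ℝ} (n m : ℕ) {u : U} (hu : u ∉ G)
    (hexit : D.exit u (π m u) = l) (t : ℝ) :
    HasDerivAt (D.lowerFn G π l (n + 1) m u)
      (∑ v, D.rate u (π m u) v * D.lowerFn G π l n (m + 1) v t -
        l * D.lowerFn G π l (n + 1) m u t) t := by
  have h := hasDerivAt_poisSum l (fun i => D.reachUnder G π i m u) n t
  convert! h using 1
  rw [mul_sub]
  congr 1
  simp only [lowerFn, poisSum, reachUnder, hu, if_false, Finset.mul_sum]
  rw [Finset.sum_comm]
  refine Finset.sum_congr rfl fun i _ => Finset.sum_congr rfl fun v _ => ?_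
  rw [← D.exit_mul_prob, hexit]
  ring

end StepCounting

variable {S Act : Type*} [Fintype S] [Fintype Act] [MeasurableSpace S]
  [DiscreteMeasurableSpace S] (C : CTMDP S Act) {l : ℝ} (hl : C.maxExit ≤ l)
  (d : ℕ → (s : S) → C.enabled s)

theorem le_reachProb_countScheduler (x : Timing) (G : Set S) {T : ℝ} (hT : 0 ≤ T)
    {W : ℕ → ℕ → S → ℝ → ℝ} (hW0 : ∀ n m s t, 0 ≤ t → 0 ≤ W n m s t)
    (hW1 : ∀ n m s t, 0 ≤ t → W n m s t ≤ 1) (hWz : ∀ m s t, W 0 m s t = 0)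
    (hWc : ∀ n m s, Continuous (W n m s))
    (hstep : ∀ k m, ∀ s ∉ G, ∀ t, 0 ≤ t →
      ENNReal.ofReal (W (k + 1) m s t) ≤ ∫⁻ r in Set.Ioc 0 t, ∑' z : S × ℕ,
        C.jumpDensity x s ((C.countScheduler x l hl d).update m s) r z.1 z.2 *
          ENNReal.ofReal (W k z.2 z.1 (t - r))) (N : ℕ) (s : S) :
    W N 0 s T ≤ reachProb (C.countScheduler x l hl d).toScheduler G T s := by
  have h := Scheduler.le_runMeasure_reach (C.countScheduler x l hl d).toScheduler G hT
    (V := fun n z t => ENNReal.ofReal (W n z.2 z.1 t))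
    (fun n z => (hWc _ _ _).measurable.ennreal_ofReal)
    (fun n z t ht => ENNReal.ofReal_le_one.2 (hW1 _ _ _ _ ht))
    (fun z t => by rw [hWz, ENNReal.ofReal_zero])
    (fun k n h hG t ht => hstep k (Hist.last h).2.2 (Hist.last h).2.1 hG t ht) N 0 rfl s
  have hfin := (C.countScheduler x l hl d).toScheduler.isProbabilityMeasure_runMeasure s
  rw [reachProb, Measure.real, ← ENNReal.toReal_ofReal (hW0 N 0 s T hT)]
  exact ENNReal.toReal_mono (measure_ne_top _ _) h

theorem lowerFn_late_le_reachProb (G : Set S) {T : ℝ} (hT : 0 ≤ T) (N : ℕ) (s : S) :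
    (C.lateUnif l hl).lowerFn G (fun k s => d k s) l N 0 s T ≤
      reachProb (C.countScheduler .late l hl d).toScheduler G T s := by
  have hl0 : 0 ≤ l := C.maxExit_nonneg.trans hl
  set D := C.lateUnif l hl with hD
  set π : ℕ → S → Act := fun k s => d k s with hπ
  refine C.le_reachProb_countScheduler hl d .late G hT (W := D.lowerFn G π l)
    (fun n m s t ht => D.lowerFn_nonneg G π (mul_nonneg hl0 ht) n m s)
    (fun n m s t ht => D.lowerFn_le_one G π (mul_nonneg hl0 ht) n m s)
    (fun m s t => D.lowerFn_zero G π l m s t)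
    (fun n m s => D.continuous_lowerFn G π l n m s) ?_ N s
  intro k m s hs t ht
  refine C.le_lintegral_jumpDensity_countScheduler .late hl d m s ht k
    (f := fun j => D.lowerFn G π l (k + 1 - j) (m + j) s)
    (fun n m s t ht => D.lowerFn_nonneg G π (mul_nonneg hl0 ht) n m s)
    (fun n n' m s t ht hn => D.lowerFn_mono G π (mul_nonneg hl0 ht) hn m s)
    (fun n m s => D.continuous_lowerFn G π l n m s) (fun j hj u => ?_) (fun u => ?_) (fun j => ?_)
  · have e1 : k + 1 - j = k - j + 1 := by omega
    have e2 : k + 1 - (j + 1) = k - j := by omega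
    have hen : π (m + j) s ∈ C.enabled s := (d (m + j) s).2
    have h := D.hasDerivAt_lowerFn G π (k - j) (m + j) hs (C.lateUnif_exit hl hen) u
    rw [C.lateUnif_sum_rate hl hen fun v => D.lowerFn G π l (k - j) (m + j + 1) v u] at h
    simp only [e1, e2]
    exact h
  · simp only [Nat.sub_self]
    exact D.lowerFn_zero G π l _ s u
  · exact D.lowerFn_zero_right G π hs l _ _

/-- The step-counting scheduler of the early uniformisation: in `(s, some a)` the action `a` is
the only choice. -/
def earlyPolicy : ℕ → S × Option Act → Act := fun k u => u.2.elim (d k u.1) id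

theorem lowerFn_early_le_reachProb (G : Set S) {T : ℝ} (hT : 0 ≤ T) (N : ℕ) (s : S) :
    (C.earlyUnif l hl).lowerFn (earlyGoal Act G) (C.earlyPolicy d) l N 0 (s, none) T ≤
      reachProb (C.countScheduler .early l hl d).toScheduler G T s := by
  have hl0 : 0 ≤ l := C.maxExit_nonneg.trans hl
  set D := C.earlyUnif l hl with hD
  set π := C.earlyPolicy d with hπ
  set H := earlyGoal Act G with hH
  refine C.le_reachProb_countScheduler hl d .early G hT
    (W := fun n m s => D.lowerFn H π l n m (s, none))
    (fun n m s t ht => D.lowerFn_nonneg H π (mul_nonneg hl0 ht) n m _)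
    (fun n m s t ht => D.lowerFn_le_one H π (mul_nonneg hl0 ht) n m _)
    (fun m s t => D.lowerFn_zero H π l m _ t)
    (fun n m s => D.continuous_lowerFn H π l n m _) ?_ N s
  intro k m s hs t ht
  -- the state of the uniformised model after `j` self-loops
  let st : ℕ → S × Option Act := fun j => (s, if j = 0 then none else some (d m s : Act))
  refine C.le_lintegral_jumpDensity_countScheduler .early hl d m s ht k
    (W := fun n m s => D.lowerFn H π l n m (s, none))
    (f := fun j => D.lowerFn H π l (k + 1 - j) (m + j) (st j))
    (fun n m s t ht => D.lowerFn_nonneg H π (mul_nonneg hl0 ht) n m _)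
    (fun n n' m s t ht hn => D.lowerFn_mono H π (mul_nonneg hl0 ht) hn m _)
    (fun n m s => D.continuous_lowerFn H π l n m _) (fun j hj u => ?_) (fun u => ?_) (fun j => ?_)
  · have e1 : k + 1 - j = k - j + 1 := by omega
    have e2 : k + 1 - (j + 1) = k - j := by omega
    have hπj : π (m + j) (st j) = d m s := by
      rcases Nat.eq_zero_or_pos j with rfl | hj0
      · simp [hπ, earlyPolicy, st]
      · simp [hπ, earlyPolicy, st, hj0.ne']
    have hen : π (m + j) (st j) ∈ D.enabled (st j) := by
      rw [hπj]
      rcases Nat.eq_zero_or_pos j with rfl | hj0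
      · exact (d m s).2
      · simp [hD, earlyUnif, st, hj0.ne']
    have h := D.hasDerivAt_lowerFn H π (k - j) (m + j) (u := st j) hs (C.earlyUnif_exit hl hen) u
    rw [C.earlyUnif_sum_rate hl hen fun v => D.lowerFn H π l (k - j) (m + j + 1) v u, hπj] at h
    simp only [e1, e2]
    exact h
  · simp only [Nat.sub_self]
    exact D.lowerFn_zero H π l _ _ u
  · exact D.lowerFn_zero_right H π (u := st j) hs l _ _

end Lower

/-! ### Optimality of the counting scheduler -/

section Optimality

variable {S Act : Type*} [Fintype S] [Fintype Act]

omit [Fintype Act] in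
theorem upperVal_zero_sub_le_gap {U : Type*} [Fintype U] (D : CTMDP U Act) (G : Set U)
    (w : ℕ → ℝ) (N : ℕ) (u : U) :
    D.upperVal G w N 0 u - D.lowerVal G w N 0 u ≤ D.gap G w N :=
  (le_abs_self _).trans (norm_le_pi_norm (D.upperVal G w N 0 - D.lowerVal G w N 0) u)

variable [MeasurableSpace S] [DiscreteMeasurableSpace S]

/-- When the test is passed, the greedy counting scheduler is optimal up to the gap and the
truncated tail of the Poisson distribution. -/
theorem value_sub_le_reachProb (C : CTMDP S Act) (x : Timing) (G : Set S) {T : ℝ} (hT : 0 ≤ T)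
    {ε κ : ℝ} (hεκ : 0 < ε * κ) {j : ℕ} (hj : C.Stops x G T ε κ j)
    {d : ℕ → (s : S) → C.enabled s} (hd : C.IsGreedy x G T ε κ j d) (s : S) :
    C.value x G T s - ε ≤
      reachProb (C.countScheduler x (C.rateAt j) (C.maxExit_le_rateAt j) d).toScheduler G T s := by
  have hl := C.maxExit_le_rateAt j
  have hl0 : 0 ≤ C.rateAt j := C.maxExit_nonneg.trans hl
  have htail := one_sub_sum_pois_truncation_le (mul_nonneg hl0 hT) hεκ
  cases x with
  | late =>
    have h1 := C.value_le_late hl G hT (truncation (C.rateAt j) T ε κ) s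
    rw [upperFn_eq_upperVal] at h1
    have h2 := C.lowerFn_late_le_reachProb hl d G hT (truncation (C.rateAt j) T ε κ) s
    rw [lowerFn_eq_lowerVal _ _ _ fun k hk u hu => (hd k u).2 hk hu] at h2
    have h3 := upperVal_zero_sub_le_gap (C.lateUnif (C.rateAt j) hl) G
      (pois (C.rateAt j * T)) (truncation (C.rateAt j) T ε κ) s
    have h4 : (C.lateUnif (C.rateAt j) hl).gap G (pois (C.rateAt j * T))
      (truncation (C.rateAt j) T ε κ) ≤ ε * (1 - κ) := hj
    linarith
  | early =>
    have h1 := C.value_le_early hl G hT (truncation (C.rateAt j) T ε κ) s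
    rw [upperFn_eq_upperVal] at h1
    have h2 := C.lowerFn_early_le_reachProb hl d G hT (truncation (C.rateAt j) T ε κ) s
    rw [lowerFn_eq_lowerVal _ _ _ ?_] at h2
    · have h3 := upperVal_zero_sub_le_gap (C.earlyUnif (C.rateAt j) hl) (earlyGoal Act G)
        (pois (C.rateAt j * T)) (truncation (C.rateAt j) T ε κ) (s, none)
      have h4 : (C.earlyUnif (C.rateAt j) hl).gap (earlyGoal Act G) (pois (C.rateAt j * T))
        (truncation (C.rateAt j) T ε κ) ≤ ε * (1 - κ) := hj
      linarith
    · rintro k hk ⟨u, _ | b⟩ hu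
      · exact (hd k u).2 hk hu
      · -- the committed action is the only one over which the maximum is taken
        rw [lowerVal_of_notMem _ _ hk hu]
        exact (Finset.sup'_singleton _).symm

end Optimality

end CTMDP

theorem mainTheorem5 {S Act : Type*} [Fintype S] [Fintype Act] [MeasurableSpace S]
    [DiscreteMeasurableSpace S] (C : CTMDP S Act) (x : Timing) (G : Set S) (T : ℝ) (hT : 0 ≤ T)
    (ε : ℝ) (hε : 0 < ε) (κ : ℝ) (hκ₀ : 0 < κ) (hκ₁ : κ < 1) :
    ∃ j : ℕ, C.Terminates x G T ε κ j ∧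
      (∃ d : ℕ → (s : S) → C.enabled s, C.IsGreedy x G T ε κ j d) ∧
      ∀ d : ℕ → (s : S) → C.enabled s, C.IsGreedy x G T ε κ j d →
        ∀ s : S, C.value x G T s - ε ≤
          CTMDP.reachProb
            (C.countScheduler x (C.rateAt j) (C.maxExit_le_rateAt j) d).toScheduler G T s := by
  obtain ⟨j, hj⟩ := C.exists_terminates x G hT hε hκ₁
  exact ⟨j, hj, C.exists_isGreedy x G T ε κ j, fun d hd s =>
    C.value_sub_le_reachProb x G hT (mul_pos hε hκ₀) hj.1 hd s⟩
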